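/- **Definitions.** For a graph $G$, $p\in(0,1]$ and a positive integer $c$, let $\mathcal G_c(G,p)$ be the random edge-coloured graph obtained by retaining each edge of $G$ independently with probability $p$ and then colouring each retained edge independently and uniformly at random with a colour from $\{1,\dots,c\}$. For a positive integer $k$, let $\mathcal G^*_{k\text{-out}}(G)$ be the random spanning subgraph of $G$ obtained as follows: orient the edges of $G$ uniformly at random to get an oriented graph $D$; then, independently, each vertex $v$ picks a uniformly random set of $\min\{k,d_D^+(v)\}$ of its out-edges; the picked edges, with orientations ignored, form the edge set of the random graph. A set of edges of an edge-coloured graph is *rainbow* if its elements have pairwise distinct colours. **Theorem.** Let $\varepsilon>0$ be a constant and let $k\ge 2$ be an integer. For each $n$ let $G=G_n$ be a graph on $n$ vertices with minimum degree $\delta(G)=\omega(\log n)$, and let $p=p_n\in(0,1]$ satisfy $p=\omega\!\left(\frac{\log n}{\delta(G)}\right)$ as $n\to\infty$. Put $$t=t_n:=\max\left\{0,\left\lceil(1-\varepsilon)\frac{\delta(G)\,p}{2k}\right\rceil\right\}.$$ Then for each $n\ge 1$ there are a random edge-coloured graph $H$ and random graphs $H_0,H_1,\dots,H_t$ on the vertex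 set of $G$, defined on a common probability space, such that $H\sim\mathcal G_{kn}(G,p)$ and $H_i\sim\mathcal G^*_{k\text{-out}}(G)$ (exactly) for every $1\le i\le t$, and such that with probability tending to $1$ as $n\to\infty$ the following hold simultaneously: 1. $H=H_0\cup H_1\cup\dots\cup H_t$; 2. $H_0,H_1,\dots,H_t$ are pairwise edge-disjoint; 3. for every $1\le i\le t$, $E(H_i)$ is rainbow in $H$. -/

import Mathlib

open Filter Topology Asymptotics
open scoped ENNReal

noncomputable section

namespace RainbowOut

/-- The product distribution: the joint law of independent random variables indexed by `ι`,
the `i`-th of which has law `μ i`. -/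
def independent {ι : Type} [Fintype ι] {α : ι → Type} [∀ i, Fintype (α i)]
    (μ : ∀ i, PMF (α i)) : PMF (∀ i, α i) := by
  classical
  exact PMF.ofFintype (fun f => ∏ i, μ i (f i)) (by
    have h := Finset.prod_univ_sum (fun i => (Finset.univ : Finset (α i))) (fun i a => μ i a)
    rw [Fintype.piFinset_univ] at h
    rw [← h]
    refine Finset.prod_eq_one fun i _ => ?_
    rw [← tsum_fintype (L := .unconditional _)]
    exact (μ i).tsum_coe)

/-- A biased coin: `true` with probability `p`, `false` with probability `1 - p`. -/
def coin (p : unitInterval) : PMF Bool :=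
  PMF.ofFintype (fun b => if b then ENNReal.ofReal p else ENNReal.ofReal (1 - p)) (by
    rw [Fintype.sum_bool]
    simp only [if_true, Bool.false_eq_true, if_false]
    rw [← ENNReal.ofReal_add p.2.1 (sub_nonneg.2 p.2.2)]
    simp)

open Classical in
/-- `𝒢(G, p)`: every edge of `G` is retained independently with probability `p`. -/
def randomSubgraph {V : Type} [Fintype V] (G : SimpleGraph V) (p : unitInterval) :
    PMF (SimpleGraph V) :=
  (independent fun _ : G.edgeSet => coin p).map fun b =>
    SimpleGraph.fromEdgeSet {e | ∃ h : e ∈ G.edgeSet, b ⟨e, h⟩ = true}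

/-- Edge-coloured graphs on the vertex set `V` with colours from a set of size `c`. -/
structure ColouredGraph (V : Type) (c : ℕ) where
  graph : SimpleGraph V
  colour : graph.edgeSet → Fin c

/-- `E(K)` is rainbow in the edge-coloured graph `H`: distinct edges of `H` that belong to `K`
have distinct colours. -/
def ColouredGraph.IsRainbow {V : Type} {c : ℕ} (H : ColouredGraph V c) (K : SimpleGraph V) :
    Prop :=
  ∀ e f : H.graph.edgeSet, (e : Sym2 V) ∈ K.edgeSet → (f : Sym2 V) ∈ K.edgeSet →
    H.colour e = H.colour f → e = f

open Classical in
/-- `𝒢_c(G, p)`: choose a random graph from `𝒢(G, p)`, then colour each of its edges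
independently and uniformly at random with one of `c` colours. -/
def randomColouredSubgraph {V : Type} [Fintype V] (G : SimpleGraph V) (p : unitInterval)
    (c : ℕ) (hc : 0 < c) : PMF (ColouredGraph V c) :=
  haveI : Nonempty (Fin c) := ⟨⟨0, hc⟩⟩
  (randomSubgraph G p).bind fun H =>
    (independent fun _ : H.edgeSet => PMF.uniformOfFintype (Fin c)).map fun col => ⟨H, col⟩

/-- An orientation of `G`, given by the tail of every edge. -/
abbrev Orientation {V : Type} (G : SimpleGraph V) : Type :=
  ∀ e : G.edgeSet, {v : V // v ∈ (e : Sym2 V)}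

instance {V : Type} (G : SimpleGraph V) : Nonempty (Orientation G) :=
  ⟨fun e => ⟨(e : Sym2 V).out.1, Sym2.out_fst_mem _⟩⟩

open Classical in
/-- The out-neighbourhood of `v` in the oriented graph given by `D`. -/
def outNeighbours {V : Type} [Fintype V] {G : SimpleGraph V} (D : Orientation G) (v : V) :
    Finset V :=
  Finset.univ.filter fun w => ∃ h : s(v, w) ∈ G.edgeSet, (D ⟨s(v, w), h⟩ : V) = v

open Classical in
/-- `𝒢*_{k-out}(G)`: orient the edges of `G` uniformly at random; then every vertex `v`
independently picks a uniformly random set of `min k d⁺(v)` of its out-edges (recorded by their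
heads); the picked edges, without their orientations, form the random graph. -/
def randomKOutStar {V : Type} [Fintype V] (G : SimpleGraph V) (k : ℕ) : PMF (SimpleGraph V) :=
  (PMF.uniformOfFintype (Orientation G)).bind fun D =>
    (independent fun v : V =>
      PMF.uniformOfFinset
        ((outNeighbours D v).powersetCard (min k (outNeighbours D v).card))
        (Finset.powersetCard_nonempty.2 (min_le_right _ _))).map fun S =>
          SimpleGraph.fromRel fun v w => w ∈ S v

/-- `H = K₀ ∪ K₁ ∪ ⋯ ∪ K_t` with edge-disjoint subgraphs `K₀, …, K_t`, where `E(K_i)` is rainbow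
for every `1 ≤ i ≤ t`. -/
def IsRainbowSplitting {V : Type} {c t : ℕ} (H : ColouredGraph V c)
    (K : Fin (t + 1) → SimpleGraph V) : Prop :=
  H.graph = ⨆ i, K i ∧
  (Pairwise fun i j => Disjoint (K i).edgeSet (K j).edgeSet) ∧
  ∀ i, i ≠ 0 → H.IsRainbow (K i)

end RainbowOut

end

open Filter Topology Asymptotics
open scoped ENNReal

noncomputable section

namespace RainbowOut

/-! Write `c = k * n` for the number of colours. Orient `G` uniformly and, independently, retain and
colour its edges. The retained edges form a bipartite multigraph between vertices (tails) and
colours. A rainbow set with `k` out-edges at every vertex has exactly `c` edges, so it uses each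
colour once: after splitting each vertex into `k` slots, it is a perfect matching between slots and
colours.

Hence `t` disjoint such sets exist as soon as there is a subgraph that is `t`-regular on slots and
colours, by König's theorem. Hall's theorem supplies it under the cut condition `t * (k|S| + |T|) ≤
t * c + e(S, T)` (`exists_rainbow_decomposition`). The mean of `e(S, T)` is at least `d * k|S||T| /
c` with `d = δp/(2k)`, while `k|S| + |T| - c ≤ k|S||T| / c`. A Chernoff bound and a union bound over
all cuts therefore give the condition with high probability when `t ≤ (1 - η)d` and `d` dominates
`log n` (`coupling_failure_le`).

The sets found depend on marks and colours, so they need not have the required law. This is repaired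
by one uniformly random permutation of the edges that preserves tails, applied to marks, colours and
sets together. Marks and colours are i.i.d. over edges, so the law of `H` is unchanged
(`coupling_map_fst`). The group acts transitively on the `k`-out sets of an orientation, so each
permuted set is exactly uniform (`coupling_map_snd`). Being disjoint, retained and rainbow survives
the permutation. -/

/-! ### Product laws and uniform laws -/

theorem independent_apply {ι : Type} [Fintype ι] {α : ι → Type} [∀ i, Fintype (α i)]
    (μ : ∀ i, PMF (α i)) (f : ∀ i, α i) : independent μ f = ∏ i, μ i (f i) := by
  simp [independent]

theorem sum_independent_mul_prod {ι : Type} [Fintype ι] {α : ι → Type} [∀ i, Fintype (α i)]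
    [Fintype (∀ i, α i)] (μ : ∀ i, PMF (α i)) (g : ∀ i, α i → ℝ≥0∞) :
    ∑ f, independent μ f * ∏ i, g i (f i) = ∏ i, ∑ a, μ i a * g i a := by
  classical
  simp_rw [independent_apply, ← Finset.prod_mul_distrib]
  have h := Finset.prod_univ_sum (fun i => (Finset.univ : Finset (α i))) (fun i a => μ i a * g i a)
  rw [Fintype.piFinset_univ] at h
  rw [h]
  congr!

theorem sum_pmf {α : Type} [Fintype α] (P : PMF α) : ∑ a, P a = 1 := by
  rw [← tsum_fintype (L := .unconditional _)]
  exact P.tsum_coe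

/-- The event `g = f ∘ r` is a condition on each coordinate separately, and coordinates outside the
range of `r` sum to one. It serves both to restrict colours to retained edges and to permute edge
labels. -/
theorem independent_map_reindex {ι κ : Type} [Fintype ι] [Fintype κ] {α : Type} [Fintype α]
    (μ : ι → PMF α) (r : κ → ι) (hr : Function.Injective r) :
    (independent μ).map (fun f j => f (r j)) = independent fun j => μ (r j) := by
  classical
  ext g
  rw [PMF.map_apply, tsum_fintype, independent_apply]
  have h : ∀ f : ι → α, (if g = fun j => f (r j) then independent μ f else 0) =
      independent μ f * ∏ i, (if ∀ j, r j = i → g j = f i then 1 else 0) := by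
    intro f
    rw [Finset.prod_ite_zero]
    simp only [Finset.mem_univ, true_implies, Finset.prod_const_one, mul_ite, mul_one, mul_zero]
    refine if_congr ?_ rfl rfl
    rw [funext_iff]
    exact ⟨fun h i j hj => hj ▸ h j, fun h j => h _ j rfl⟩
  rw [show (∑ f, _ : ℝ≥0∞) = _ from Finset.sum_congr rfl fun f _ => (by convert h f),
    sum_independent_mul_prod μ fun i a => if ∀ j, r j = i → g j = a then 1 else 0]
  rw [← Finset.prod_subset (Finset.subset_univ (Finset.univ.image r)),
    Finset.prod_image hr.injOn]
  · refine Finset.prod_congr rfl fun j _ => ?_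
    rw [Finset.sum_eq_single (g j)]
    · rw [if_pos, mul_one]
      intro j' hj'
      rw [hr hj']
    · intro a _ ha
      rw [if_neg, mul_zero]
      exact fun h => ha (h j rfl).symm
    · simp
  · intro i _ hi
    refine Eq.trans (Finset.sum_congr rfl fun a _ => ?_) (sum_pmf (μ i))
    rw [if_pos, mul_one]
    rintro j rfl
    simp at hi

theorem uniformOfFintype_pi {ι : Type} [Fintype ι] {α : ι → Type} [∀ i, Fintype (α i)]
    [∀ i, Nonempty (α i)] [Fintype (∀ i, α i)] :
    PMF.uniformOfFintype (∀ i, α i) = independent fun i => PMF.uniformOfFintype (α i) := by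
  classical
  ext f
  simp only [independent_apply, PMF.uniformOfFintype_apply]
  rw [← ENNReal.prod_inv_distrib (fun _ _ _ _ _ => Or.inl (by simp)), ← Nat.cast_prod,
    ← Fintype.card_pi]
  congr!

/-- A map whose fibres are permuted transitively by bijections of its domain sends the uniform
distribution to the uniform distribution. -/
theorem uniformOfFintype_map_of_transitive {Γ X : Type} [Fintype Γ] [Nonempty Γ] [Fintype X]
    [Nonempty X] (F : Γ → X) (h : ∀ x y, ∃ e : Γ ≃ Γ, ∀ γ, F (e γ) = y ↔ F γ = x) :
    (PMF.uniformOfFintype Γ).map F = PMF.uniformOfFintype X := by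
  classical
  have hconst : ∀ x y, (PMF.uniformOfFintype Γ).map F x = (PMF.uniformOfFintype Γ).map F y := by
    intro x y
    obtain ⟨e, he⟩ := h x y
    simp only [PMF.map_apply, tsum_fintype, PMF.uniformOfFintype_apply]
    rw [← e.sum_comp (fun γ => if y = F γ then ((Fintype.card Γ : ℝ≥0∞))⁻¹ else 0)]
    refine Finset.sum_congr rfl fun γ _ => if_congr ?_ rfl rfl
    rw [eq_comm, ← he, eq_comm]
  ext x
  have h1 := sum_pmf ((PMF.uniformOfFintype Γ).map F)
  rw [Finset.sum_congr rfl fun y _ => hconst y x, Finset.sum_const, nsmul_eq_mul,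
    Finset.card_univ, mul_comm] at h1
  rw [PMF.uniformOfFintype_apply]
  exact ENNReal.eq_inv_of_mul_eq_one_left h1

/-- `Θ` identifies `X` with the box `∏ Q i`, on which the product of uniform laws is uniform. -/
theorem uniformOfFintype_map_eq_independent {ι X : Type} [Fintype ι] [Fintype X] [Nonempty X]
    {β : ι → Type} [∀ i, Fintype (β i)] (Q : ∀ i, Finset (β i)) (hQ : ∀ i, (Q i).Nonempty)
    (Θ : X → ∀ i, β i) (hΘ : Function.Injective Θ) (hr : ∀ f, (∃ x, Θ x = f) ↔ ∀ i, f i ∈ Q i) :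
    (PMF.uniformOfFintype X).map Θ = independent fun i => PMF.uniformOfFinset (Q i) (hQ i) := by
  classical
  have hcard : Fintype.card X = ∏ i, (Q i).card := by
    rw [← Fintype.card_piFinset, ← Finset.card_univ, ← Finset.card_image_of_injective _ hΘ]
    congr 1
    ext f
    simp [← hr]
  ext f
  rw [independent_apply, PMF.map_apply, tsum_fintype]
  simp only [PMF.uniformOfFintype_apply, PMF.uniformOfFinset_apply]
  by_cases hf : ∀ i, f i ∈ Q i
  · obtain ⟨x, rfl⟩ := (hr f).2 hf
    rw [Finset.sum_eq_single x (fun y _ hy => if_neg fun h => hy (hΘ h).symm) (by simp), if_pos rfl,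
      Finset.prod_congr rfl fun i _ => if_pos (hf i), hcard,
      ← ENNReal.prod_inv_distrib (fun i _ j _ _ => Or.inl (by simpa using (hQ i).ne_empty)),
      Nat.cast_prod]
  · rw [Finset.sum_eq_zero fun x _ => if_neg fun h => hf ((hr f).1 ⟨x, h.symm⟩)]
    push Not at hf
    obtain ⟨i, hi⟩ := hf
    exact (Finset.prod_eq_zero (Finset.mem_univ i) (if_neg hi)).symm

/-! ### Rainbow decompositions of bipartite multigraphs -/

open Finset in
/-- A form of the Ore–Ryser theorem for bipartite multigraphs. -/
theorem exists_injective_slots {V C E : Type} [Fintype V] [Fintype C] [Fintype E]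
    [DecidableEq V] [DecidableEq C] [DecidableEq E] (tail : E → V) (col : E → C) (k t : ℕ)
    (hcard : Fintype.card C = k * Fintype.card V)
    (hcut : ∀ (S : Finset V) (T : Finset C),
      t * (k * #S + #T) ≤ t * Fintype.card C + #{e : E | tail e ∈ S ∧ col e ∈ T}) :
    ∃ φ : V × Fin k × Fin t → E, Function.Injective φ ∧ (∀ x, tail (φ x) = x.1) ∧
      ∀ c, #{x | col (φ x) = c} = t := by
  -- A slot may take any edge with its tail; an edge may take itself or one of the `t` tokens of its
  -- colour. An edge taken by a slot must then use a token, so each colour serves at most `t` slots.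
  let N : (V × Fin k × Fin t) ⊕ E → Finset (E ⊕ (C × Fin t)) := fun l =>
    Sum.elim (fun x => ({e : E | tail e = x.1} : Finset E).disjSum ∅)
      (fun e => ({e} : Finset E).disjSum (({col e} : Finset C) ×ˢ univ)) l
  have hall : ∀ s : Finset ((V × Fin k × Fin t) ⊕ E), #s ≤ #(s.biUnion N) := by
    intro s
    set S : Finset V := s.toLeft.image Prod.fst with hS
    set Y : Finset E := s.toRight with hY
    set T : Finset C := (Y.image col)ᶜ with hT
    have h1 : #s ≤ #S * (k * t) + #Y := by
      rw [← s.card_toLeft_add_card_toRight]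
      gcongr
      have : s.toLeft ⊆ S ×ˢ (univ : Finset (Fin k × Fin t)) := by
        intro x hx
        simp only [mem_product, mem_univ, and_true, hS]
        exact mem_image_of_mem _ hx
      simpa using card_le_card this
    have h2 : (({e : E | tail e ∈ S} : Finset E) ∪ Y).disjSum ((Y.image col) ×ˢ univ) ⊆
        s.biUnion N := by
      intro r hr
      rw [mem_biUnion]
      rcases r with e | ⟨c, i⟩
      · rw [inl_mem_disjSum, mem_union] at hr
        rcases hr with hr | hr
        · simp only [hS, mem_filter, mem_univ, true_and, mem_image] at hr
          obtain ⟨x, hx, hxe⟩ := hr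
          exact ⟨Sum.inl x, mem_toLeft.1 hx, by simp [N, hxe]⟩
        · exact ⟨Sum.inr e, mem_toRight.1 hr, by simp [N]⟩
      · simp only [inr_mem_disjSum, mem_product, mem_univ, and_true, mem_image] at hr
        obtain ⟨e, he, rfl⟩ := hr
        exact ⟨Sum.inr e, mem_toRight.1 he, by simp [N]⟩
    have h3 := card_le_card h2
    rw [card_disjSum, card_product, card_univ, Fintype.card_fin] at h3
    -- `T` consists of the colours absent from `Y`, so the edges counted by the cut `(S, T)` are
    -- neighbours lying outside `Y`.
    have h4 : #Y + #{e : E | tail e ∈ S ∧ col e ∈ T} ≤ #(({e : E | tail e ∈ S} : Finset E) ∪ Y) := by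
      rw [← card_union_of_disjoint]
      · apply card_le_card
        intro e
        simp only [mem_union, mem_filter, mem_univ, true_and]
        tauto
      · rw [disjoint_left]
        intro e he
        simp only [mem_filter, mem_univ, true_and, hT, mem_compl, not_and, not_not]
        exact fun _ => mem_image_of_mem _ he
    have h5 := hcut S T
    have h6 : #T + #(Y.image col) = Fintype.card C := card_compl_add_card _
    rw [← h6] at h5
    nlinarith
  obtain ⟨f, hf, hfN⟩ := (all_card_le_biUnion_card_iff_exists_injective N).1 hall
  have hφ : ∀ x, ∃ e, f (Sum.inl x) = Sum.inl e ∧ tail e = x.1 := by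
    intro x
    have := hfN (Sum.inl x)
    rcases hfx : f (Sum.inl x) with e | r <;> rw [hfx] at this <;> simp [N] at this
    exact ⟨e, rfl, this⟩
  choose φ hφ1 hφ2 using hφ
  have hψ : ∀ x, ∃ i, f (Sum.inr (φ x)) = Sum.inr (col (φ x), i) := by
    intro x
    have := hfN (Sum.inr (φ x))
    rcases hfx : f (Sum.inr (φ x)) with e | ⟨c, i⟩ <;> rw [hfx] at this <;> simp [N] at this
    · subst this
      rw [← hφ1] at hfx
      exact absurd (hf hfx) (by simp)
    · exact ⟨i, by rw [this]⟩
  choose ψ hψ using hψ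
  have hφi : Function.Injective φ := by
    intro x y hxy
    have : f (Sum.inl x) = f (Sum.inl y) := by rw [hφ1, hφ1, hxy]
    simpa using hf this
  have hle : ∀ c ∈ (univ : Finset C), #{x | col (φ x) = c} ≤ t := by
    intro c _
    have : #{x | col (φ x) = c} ≤ #(univ : Finset (Fin t)) := by
      refine card_le_card_of_injOn ψ (fun _ _ => mem_coe.2 (mem_univ _)) ?_
      intro x hx y hy hxy
      simp only [coe_filter, mem_univ, true_and, Set.mem_ofPred_eq] at hx hy
      have : f (Sum.inr (φ x)) = f (Sum.inr (φ y)) := by rw [hψ, hψ, hx, hy, hxy]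
      exact hφi (by simpa using hf this)
    simpa using this
  -- There are `t * |C|` slots in all, so the upper bound `t` is attained at every colour.
  have hsum : ∑ c, #{x | col (φ x) = c} = ∑ _c : C, t := by
    rw [← card_eq_sum_card_fiberwise (fun _ _ => mem_coe.2 (mem_univ _))]
    simp [hcard]
    ring
  exact ⟨φ, hφi, hφ2, fun c => (sum_eq_sum_iff_of_le hle).1 hsum c (mem_univ c)⟩

open Finset in
/-- König's edge-colouring theorem for regular bipartite multigraphs. -/
theorem exists_edge_colouring_of_regular {A C ι : Type} [Fintype A] [Fintype C]
    [DecidableEq A] [DecidableEq C] [DecidableEq ι] (a : ι → A) (c : ι → C) (t : ℕ)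
    (P : Finset ι) (ha : ∀ x, #{e ∈ P | a e = x} = t) (hc : ∀ y, #{e ∈ P | c e = y} = t) :
    ∃ g : ι → ℕ, (∀ e ∈ P, g e < t) ∧
      ∀ e ∈ P, ∀ e' ∈ P, g e = g e' → (a e = a e' ∨ c e = c e') → e = e' := by
  induction t generalizing P with
  | zero =>
    have : P = ∅ := by
      rw [eq_empty_iff_forall_notMem]
      intro e he
      have := ha (a e)
      rw [card_eq_zero, filter_eq_empty_iff] at this
      exact this he rfl
    subst this
    exact ⟨fun _ => 0, by simp, by simp⟩
  | succ t ih =>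
    have hA : ∀ s : Finset A, #{e ∈ P | a e ∈ s} = (t + 1) * #s := by
      intro s
      rw [card_eq_sum_card_fiberwise (f := a) (t := s) (fun e he => by simp at he; exact he.2),
        sum_congr rfl (g := fun _ => t + 1), sum_const, smul_eq_mul, mul_comm]
      intro x hx
      rw [← ha x, filter_filter]
      congr 1
      ext e
      simp only [mem_filter]
      exact ⟨fun h => ⟨h.1, h.2.2⟩, fun h => ⟨h.1, h.2 ▸ hx, h.2⟩⟩
    have hC : ∀ s : Finset C, #{e ∈ P | c e ∈ s} = (t + 1) * #s := by
      intro s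
      rw [card_eq_sum_card_fiberwise (f := c) (t := s) (fun e he => by simp at he; exact he.2),
        sum_congr rfl (g := fun _ => t + 1), sum_const, smul_eq_mul, mul_comm]
      intro x hx
      rw [← hc x, filter_filter]
      congr 1
      ext e
      simp only [mem_filter]
      exact ⟨fun h => ⟨h.1, h.2.2⟩, fun h => ⟨h.1, h.2 ▸ hx, h.2⟩⟩
    let N : A → Finset C := fun x => ({e ∈ P | a e = x} : Finset ι).image c
    -- The `(t + 1)|s|` edges at `s` all end in the neighbourhood of `s`, which meets `t + 1` edges
    -- per vertex.
    have hall : ∀ s : Finset A, #s ≤ #(s.biUnion N) := by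
      intro s
      have : #{e ∈ P | a e ∈ s} ≤ #{e ∈ P | c e ∈ s.biUnion N} := by
        apply card_le_card
        intro e
        simp only [mem_filter, mem_biUnion, mem_image, N]
        exact fun h => ⟨h.1, a e, h.2, e, ⟨h.1, rfl⟩, rfl⟩
      rw [hA, hC] at this
      exact Nat.le_of_mul_le_mul_left this t.succ_pos
    obtain ⟨f, hf, hfN⟩ := (all_card_le_biUnion_card_iff_exists_injective N).1 hall
    -- Equal sides make the matching perfect on `C` too, so its removal lowers every degree on both
    -- sides by one.
    have hcards : Fintype.card A = Fintype.card C := by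
      have h1 := hA univ
      have h2 := hC univ
      simp only [mem_univ, card_univ] at h1 h2
      exact Nat.eq_of_mul_eq_mul_left t.succ_pos (h1.symm.trans h2)
    have hfb : Function.Bijective f := (Fintype.bijective_iff_injective_and_card f).2 ⟨hf, hcards⟩
    have hm : ∀ x, ∃ e, e ∈ P ∧ a e = x ∧ c e = f x := by
      intro x
      have := hfN x
      simp only [N, mem_image, mem_filter] at this
      obtain ⟨e, ⟨h1, h2⟩, h3⟩ := this
      exact ⟨e, h1, h2, h3⟩
    choose m hmP hma hmc using hm
    have key : ∀ (B : Type) [DecidableEq B] (b : ι → B) (y : B) (x : A), #{e ∈ P | b e = y} = t + 1 →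
        (∀ x', b (m x') = y ↔ x' = x) → #{e ∈ P \ univ.image m | b e = y} = t := by
      intro B _ b y x h hx
      have : ({e ∈ P \ univ.image m | b e = y} : Finset ι) = ({e ∈ P | b e = y} : Finset ι).erase (m x) := by
        ext e
        simp only [mem_filter, Finset.mem_sdiff, mem_image, mem_univ, true_and, mem_erase, not_exists]
        constructor
        · rintro ⟨⟨h1, h2⟩, h3⟩
          exact ⟨fun h => h2 x h.symm, h1, h3⟩
        · rintro ⟨h1, h2, h3⟩
          refine ⟨⟨h2, fun x' hx' => h1 ?_⟩, h3⟩
          rw [← hx', (hx x').1 (hx' ▸ h3)]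
      rw [this, card_erase_of_mem, h, Nat.add_sub_cancel]
      simp [hmP, (hx x).2 rfl]
    obtain ⟨g, hg1, hg2⟩ := ih (P \ univ.image m)
      (fun x => key A a x x (ha x) fun x' => by rw [hma])
      (fun y => by
        obtain ⟨x, rfl⟩ := hfb.2 y
        exact key C c (f x) x (hc _) fun x' => by rw [hmc, hf.eq_iff])
    refine ⟨fun e => if e ∈ univ.image m then t else g e, ?_, ?_⟩
    · intro e he
      dsimp only
      split_ifs with h
      · omega
      · exact (hg1 e (Finset.mem_sdiff.2 ⟨he, h⟩)).trans (Nat.lt_succ_self t)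
    · intro e he e' he' hge hor
      dsimp only at hge
      split_ifs at hge with h h' h'
      · simp only [mem_image, mem_univ, true_and] at h h'
        obtain ⟨x, rfl⟩ := h
        obtain ⟨x', rfl⟩ := h'
        rw [hma, hma, hmc, hmc, hf.eq_iff, or_self] at hor
        rw [hor]
      · exact absurd (hg1 e' (Finset.mem_sdiff.2 ⟨he', h'⟩)) (by omega)
      · exact absurd (hg1 e (Finset.mem_sdiff.2 ⟨he, h⟩)) (by omega)
      · exact hg2 e (Finset.mem_sdiff.2 ⟨he, h⟩) e' (Finset.mem_sdiff.2 ⟨he', h'⟩) hge hor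

open Finset in
/-- Under the cut condition, the edge set contains `t` disjoint rainbow `k`-out subsets. -/
theorem exists_rainbow_decomposition {V C E : Type} [Fintype V] [Fintype C]
    [DecidableEq V] [DecidableEq C] [DecidableEq E] (tail : E → V) (col : E → C) (P : Finset E)
    (k t : ℕ) (hcard : Fintype.card C = k * Fintype.card V)
    (hcut : ∀ (S : Finset V) (T : Finset C),
      t * (k * #S + #T) ≤ t * Fintype.card C + #{e ∈ P | tail e ∈ S ∧ col e ∈ T}) :
    ∃ M : Fin t → Finset E, (∀ i, M i ⊆ P) ∧ (Pairwise fun i j => Disjoint (M i) (M j)) ∧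
      (∀ i v, #{e ∈ M i | tail e = v} = k) ∧ ∀ i, Set.InjOn col (M i) := by
  obtain ⟨φ, hφ, hφt, hφc⟩ := exists_injective_slots (E := P) (fun e => tail e) (fun e => col e)
    k t hcard (fun S T => by
      refine (hcut S T).trans (Nat.add_le_add_left (le_of_eq ?_) _)
      rw [← Finset.card_map (Function.Embedding.subtype (· ∈ P))]
      congr 1
      ext e
      simp [and_comm, and_assoc])
  obtain ⟨g, hg1, hg2⟩ := exists_edge_colouring_of_regular
    (fun x : V × Fin k × Fin t => (x.1, x.2.1)) (fun x => col (φ x)) t univ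
    (fun ⟨v, j⟩ => by
      have : ({x | (x.1, x.2.1) = (v, j)} : Finset (V × Fin k × Fin t)) =
          univ.map ⟨fun l : Fin t => (v, j, l), fun l l' h => by simpa using h⟩ := by
        ext ⟨v', j', l⟩
        simp only [mem_filter, mem_univ, true_and, Finset.mem_map, Prod.mk.injEq]
        exact ⟨fun h => ⟨l, by rw [h.1, h.2]; rfl⟩, fun ⟨_, h⟩ => by cases h; exact ⟨rfl, rfl⟩⟩
      rw [this, card_map, card_univ, Fintype.card_fin]) hφc
  have hφ' : Function.Injective fun x => (φ x : E) := Subtype.val_injective.comp hφ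
  refine ⟨fun i => ({x | g x = i} : Finset _).image fun x => (φ x : E), ?_, ?_, ?_, ?_⟩
  · intro i e he
    obtain ⟨x, _, rfl⟩ := mem_image.1 he
    exact (φ x).2
  · intro i j hij
    rw [disjoint_left]
    intro e he he'
    simp only [mem_image, mem_filter, mem_univ, true_and] at he he'
    obtain ⟨x, hx, rfl⟩ := he
    obtain ⟨y, hy, hxy⟩ := he'
    rw [hφ' hxy] at hy
    exact hij (Fin.ext (hx.symm.trans hy))
  · intro i v
    -- The `t` edges at `(v, j)` receive distinct classes among `t`, so each class occurs there
    -- exactly once; the `k` values of `j` then give `k` edges at `v`.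
    have hbij : ∀ j : Fin k, ∃ l : Fin t, g (v, j, l) = i := by
      intro j
      have : Function.Injective fun l : Fin t => (⟨g (v, j, l), hg1 _ (mem_univ _)⟩ : Fin t) := by
        intro l l' h
        have := hg2 (v, j, l) (mem_univ _) (v, j, l') (mem_univ _) (by simpa using h) (Or.inl rfl)
        simpa using this
      obtain ⟨l, hl⟩ := (Finite.injective_iff_surjective.1 this) i
      exact ⟨l, congrArg Fin.val hl⟩
    choose l hl using hbij
    have : ({e ∈ ({x | g x = i} : Finset _).image fun x => (φ x : E) | tail e = v} : Finset E) =
        univ.map ⟨fun j : Fin k => (φ (v, j, l j) : E), fun j j' h => by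
          exact congrArg (fun x => x.2.1) (hφ' h)⟩ := by
      ext e
      simp only [mem_filter, mem_image, mem_univ, true_and, Finset.mem_map]
      constructor
      · rintro ⟨⟨⟨v', j, l'⟩, hx, rfl⟩, ht⟩
        rw [hφt] at ht
        dsimp only at ht
        subst ht
        refine ⟨j, ?_⟩
        change (φ (v', j, l j) : E) = _
        rw [hg2 (v', j, l j) (mem_univ _) (v', j, l') (mem_univ _) (by rw [hl, hx]) (Or.inl rfl)]
      · rintro ⟨j, rfl⟩
        exact ⟨⟨_, hl j, rfl⟩, hφt _⟩
    rw [this, card_map, card_univ, Fintype.card_fin]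
  · intro i e he e' he' h
    simp only [coe_image, coe_filter, mem_univ, true_and, Set.mem_image, Set.mem_ofPred_eq] at he he'
    obtain ⟨x, hx, rfl⟩ := he
    obtain ⟨y, hy, rfl⟩ := he'
    rw [hg2 x (mem_univ _) y (mem_univ _) (by rw [hx, hy]) (Or.inr h)]

/-! ### Uniform `k`-out sets and tail-preserving permutations -/

variable {V : Type} [Fintype V] {G : SimpleGraph V}

open Classical in
/-- Sets of edges containing `min k d⁺(v)` out-edges of every vertex `v`. -/
def KOutSet (D : Orientation G) (k : ℕ) : Type :=
  {T : Finset G.edgeSet // ∀ v, (T.filter fun e => (D e : V) = v).card =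
    min k (Finset.univ.filter fun e => (D e : V) = v).card}

open Classical in
instance (D : Orientation G) (k : ℕ) : Fintype (KOutSet D k) :=
  inferInstanceAs (Fintype {_T : Finset G.edgeSet // _})

instance (D : Orientation G) (k : ℕ) : Nonempty (KOutSet D k) := by
  classical
  have h : ∀ v, ∃ U ⊆ (Finset.univ.filter fun e => (D e : V) = v),
      U.card = min k (Finset.univ.filter fun e => (D e : V) = v).card :=
    fun v => Finset.exists_subset_card_eq (min_le_right _ _)
  choose U hU hcard using h
  refine ⟨⟨Finset.univ.filter fun e => e ∈ U (D e), fun v => ?_⟩⟩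
  rw [← hcard]
  congr 1
  ext e
  simp only [Finset.mem_filter, Finset.mem_univ, true_and]
  constructor
  · rintro ⟨h, rfl⟩
    exact h
  · intro h
    have := hU v h
    simp only [Finset.mem_filter, Finset.mem_univ, true_and] at this
    exact ⟨this.symm ▸ h, this⟩

/-- The permutations of the edges that preserve tails. -/
def tailStabilizer (D : Orientation G) : Subgroup (Equiv.Perm G.edgeSet) where
  carrier := {π | ∀ e, (D (π e) : V) = D e}
  mul_mem' := fun {a b} ha hb e => (ha (b e)).trans (hb e)
  one_mem' := fun _ => rfl
  inv_mem' := fun {a} ha e => by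
    have := ha (a⁻¹ e)
    rw [show a (a⁻¹ e) = e from a.apply_symm_apply e] at this
    exact this.symm

open Classical in
instance (D : Orientation G) : Fintype (tailStabilizer D) := Fintype.ofFinite _

open Classical in
/-- The image of a `k`-out set under a tail-preserving permutation. -/
def KOutSet.image {D : Orientation G} {k : ℕ} (T : KOutSet D k) (π : tailStabilizer D) :
    KOutSet D k :=
  ⟨T.1.map π.1.toEmbedding, fun v => by
    rw [← T.2 v, Finset.filter_map, Finset.card_map]
    congr 1
    ext e
    have := π.2 e
    simp [this]⟩

-- Among the edges with a given tail, `x` and `y` have equally many members and equally many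
-- non-members, so these classes can be matched by bijections.
open Classical in
theorem exists_image_eq {D : Orientation G} {k : ℕ} (x y : KOutSet D k) :
    ∃ τ : tailStabilizer D, x.image τ = y := by
  let g : KOutSet D k → G.edgeSet → V × Bool := fun z e => ((D e : V), decide (e ∈ z.1))
  have hcard : ∀ z : KOutSet D k, ∀ v, ∀ b, Fintype.card {e // g z e = (v, b)} =
      if b then min k (Finset.univ.filter fun e => (D e : V) = v).card else
      (Finset.univ.filter fun e => (D e : V) = v).card -
        min k (Finset.univ.filter fun e => (D e : V) = v).card := by
    intro z v b
    rw [Fintype.card_subtype]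
    have hz := z.2 v
    have hs := Finset.card_filter_add_card_filter_not (s := Finset.univ.filter fun e => (D e : V) = v)
      (fun e => e ∈ z.1)
    have h1 : ((Finset.univ.filter fun e => (D e : V) = v).filter fun e => e ∈ z.1) =
        z.1.filter fun e => (D e : V) = v := by
      ext e
      simp [and_comm]
    rw [h1] at hs
    cases b
    · rw [if_neg (by simp), ← hz, ← hs, Nat.add_sub_cancel_left, Finset.filter_filter]
      congr 1
      ext e
      simp [g]
    · rw [if_pos rfl, ← hz]
      congr 1
      ext e
      simp [g, and_comm]
  have he : ∀ c : V × Bool, Nonempty ({e // g x e = c} ≃ {e // g y e = c}) := fun c =>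
    ⟨Fintype.equivOfCardEq ((hcard x c.1 c.2).trans (hcard y c.1 c.2).symm)⟩
  let φ := fun c => (he c).some
  let τ : Equiv.Perm G.edgeSet := Equiv.ofFiberEquiv φ
  have hτ : ∀ e, g y (τ e) = g x e := Equiv.ofFiberEquiv_map φ
  refine ⟨⟨τ, fun e => congrArg Prod.fst (hτ e)⟩, Subtype.ext ?_⟩
  ext e
  obtain ⟨e, rfl⟩ := τ.surjective e
  have := congrArg Prod.snd (hτ e)
  simp only [g, decide_eq_decide] at this
  rw [this]
  simp [KOutSet.image]

/-- If `τ` sends `x` to `y`, left multiplication by `τ` carries the permutations sending `T` to `x`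
onto those sending `T` to `y`. -/
theorem uniform_map_image {D : Orientation G} {k : ℕ} (T : KOutSet D k) :
    (PMF.uniformOfFintype (tailStabilizer D)).map T.image =
      PMF.uniformOfFintype (KOutSet D k) := by
  classical
  refine uniformOfFintype_map_of_transitive _ fun x y => ?_
  obtain ⟨τ, hτ⟩ := exists_image_eq x y
  refine ⟨Equiv.mulLeft τ, fun γ => ?_⟩
  have h : T.image (τ * γ) = (T.image γ).image τ := by
    apply Subtype.ext
    simp only [KOutSet.image, Finset.map_map]
    rfl
  rw [Equiv.coe_mulLeft, h, ← hτ]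
  constructor
  · intro h
    exact Subtype.ext (Finset.map_injective _ (congrArg Subtype.val h))
  · rintro rfl
    rfl

/-! ### The law of `𝒢*_{k-out}` in terms of edge sets -/

open Classical in
/-- The heads of the edges of `T` with tail `v`. -/
def heads (D : Orientation G) (T : Finset G.edgeSet) (v : V) : Finset V :=
  Finset.univ.filter fun w => ∃ h : s(v, w) ∈ G.edgeSet, (D ⟨s(v, w), h⟩ : V) = v ∧ ⟨s(v, w), h⟩ ∈ T

theorem mem_heads {D : Orientation G} {T : Finset G.edgeSet} {v w : V} : w ∈ heads D T v ↔
    ∃ h : s(v, w) ∈ G.edgeSet, (D ⟨s(v, w), h⟩ : V) = v ∧ ⟨s(v, w), h⟩ ∈ T := by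
  simp [heads]

theorem outNeighbours_eq_heads [Fintype G.edgeSet] (D : Orientation G) (v : V) :
    outNeighbours D v = heads D Finset.univ v := by
  ext w
  simp [mem_heads, outNeighbours]

open Classical in
theorem card_heads (D : Orientation G) (T : Finset G.edgeSet) (v : V) :
    (heads D T v).card = (T.filter fun e => (D e : V) = v).card := by
  refine Finset.card_bij (fun w hw => ⟨s(v, w), (mem_heads.1 hw).choose⟩) ?_ ?_ ?_
  · intro w hw
    obtain ⟨h, h1, h2⟩ := mem_heads.1 hw
    exact Finset.mem_filter.2 ⟨h2, h1⟩
  · intro w hw w' hw' h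
    exact Sym2.congr_right.1 (congrArg Subtype.val h)
  · intro e he
    obtain ⟨he', rfl⟩ := Finset.mem_filter.1 he
    obtain ⟨w, hw⟩ := (D e).2
    have hs : (⟨s((D e : V), w), hw ▸ e.2⟩ : G.edgeSet) = e := Subtype.ext hw.symm
    exact ⟨w, mem_heads.2 ⟨hw ▸ e.2, by rw [hs], by rw [hs]; exact he'⟩, hs⟩

/-- The spanning subgraph with edge set `T`. -/
def edgesGraph (T : Finset G.edgeSet) : SimpleGraph V :=
  SimpleGraph.fromEdgeSet ((↑) '' (T : Set G.edgeSet))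

omit [Fintype V] in
theorem mem_edgeSet_edgesGraph {T : Finset G.edgeSet} {e : Sym2 V} :
    e ∈ (edgesGraph T).edgeSet ↔ ∃ h : e ∈ G.edgeSet, ⟨e, h⟩ ∈ T := by
  rw [edgesGraph, SimpleGraph.edgeSet_fromEdgeSet]
  constructor
  · rintro ⟨⟨e, he, rfl⟩, _⟩
    exact ⟨e.2, he⟩
  · rintro ⟨h, he⟩
    exact ⟨⟨_, he, rfl⟩, SimpleGraph.not_isDiag_of_mem_edgeSet _ h⟩

theorem fromRel_heads (D : Orientation G) (T : Finset G.edgeSet) :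
    SimpleGraph.fromRel (fun v w => w ∈ heads D T v) = edgesGraph T := by
  ext v w
  rw [SimpleGraph.fromRel_adj, ← SimpleGraph.mem_edgeSet, mem_edgeSet_edgesGraph]
  simp only [mem_heads]
  constructor
  · rintro ⟨_, ⟨h, _, h2⟩ | ⟨h, _, h2⟩⟩
    · exact ⟨h, h2⟩
    · have hs : s(w, v) = s(v, w) := Sym2.eq_swap
      refine ⟨hs ▸ h, ?_⟩
      convert h2 using 2
      exact hs.symm
  · rintro ⟨h, h2⟩
    refine ⟨(G.mem_edgeSet.1 h).ne, ?_⟩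
    rcases Sym2.mem_iff.1 (D ⟨s(v, w), h⟩).2 with h3 | h3
    · exact Or.inl ⟨h, h3, h2⟩
    · right
      have hs : s(w, v) = s(v, w) := Sym2.eq_swap
      have hs' : (⟨s(w, v), hs ▸ h⟩ : G.edgeSet) = ⟨s(v, w), h⟩ := Subtype.ext hs
      exact ⟨hs ▸ h, (congrArg (fun e => (D e : V)) hs').trans h3, by rw [hs']; exact h2⟩

theorem heads_injective (D : Orientation G) : Function.Injective (heads D) := by
  intro T T' h
  ext e
  obtain ⟨w, hw⟩ := (D e).2
  have hs : (⟨s((D e : V), w), hw ▸ e.2⟩ : G.edgeSet) = e := Subtype.ext hw.symm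
  have h1 : ∀ T, w ∈ heads D T (D e) ↔ e ∈ T := by
    intro T
    rw [mem_heads]
    constructor
    · rintro ⟨_, _, h⟩
      rwa [hs] at h
    · intro h
      exact ⟨hw ▸ e.2, by rw [hs], by rwa [hs]⟩
  rw [← h1 T, h, h1]

open Classical in
theorem exists_heads_eq (D : Orientation G) (S : V → Finset V)
    (hS : ∀ v, S v ⊆ outNeighbours D v) : ∃ T : Finset G.edgeSet, heads D T = S := by
  refine ⟨Finset.univ.filter fun e => ∃ v w, (e : Sym2 V) = s(v, w) ∧ (D e : V) = v ∧ w ∈ S v, ?_⟩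
  ext v w
  simp only [mem_heads, Finset.mem_filter, Finset.mem_univ, true_and]
  constructor
  · rintro ⟨h, h1, v', w', h2, h3, h4⟩
    obtain rfl : v = v' := h1.symm.trans h3
    rwa [Sym2.congr_right.1 h2]
  · intro h
    have h1 := hS v h
    simp only [outNeighbours, Finset.mem_filter, Finset.mem_univ, true_and] at h1
    obtain ⟨h2, h3⟩ := h1
    exact ⟨h2, h3, v, w, rfl, h3, h⟩

-- Each edge has a single tail, so choosing heads at all vertices amounts to choosing one edge set,
-- and the `k`-out sets correspond to a full box of choices.
open Classical in
theorem randomKOutStar_eq (G : SimpleGraph V) (k : ℕ) : randomKOutStar G k =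
    (PMF.uniformOfFintype (Orientation G)).bind fun D =>
      (PMF.uniformOfFintype (KOutSet D k)).map fun T => edgesGraph T.1 := by
  classical
  unfold randomKOutStar
  congr 1
  funext D
  rw [← uniformOfFintype_map_eq_independent _ _ (fun T : KOutSet D k => heads D T.1), PMF.map_comp]
  · congr 1
    funext T
    exact fromRel_heads D T.1
  · intro T T' h
    exact Subtype.ext (heads_injective D h)
  · intro S
    simp only [Finset.mem_powersetCard]
    constructor
    · rintro ⟨T, rfl⟩ v
      refine ⟨fun w hw => ?_, ?_⟩
      · obtain ⟨h, h1, _⟩ := mem_heads.1 hw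
        simp only [outNeighbours, Finset.mem_filter, Finset.mem_univ, true_and]
        exact ⟨h, h1⟩
      · rw [card_heads, T.2 v, outNeighbours_eq_heads, card_heads]
    · intro h
      obtain ⟨T, rfl⟩ := exists_heads_eq D S fun v => (h v).1
      refine ⟨⟨T, fun v => ?_⟩, rfl⟩
      rw [← card_heads, (h v).2, outNeighbours_eq_heads, card_heads]

/-! ### Coloured graphs and good families -/

omit [Fintype V] in
theorem mem_of_mem_edgeSet_fromEdgeSet {s : Set (Sym2 V)} {e : Sym2 V}
    (h : e ∈ (SimpleGraph.fromEdgeSet s).edgeSet) : e ∈ s := by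
  rw [SimpleGraph.edgeSet_fromEdgeSet] at h
  exact h.1

/-- The coloured graph given by retention marks and colours of all edges of `G`. -/
def colouredOf {c : ℕ} (b : G.edgeSet → Bool) (col : G.edgeSet → Fin c) : ColouredGraph V c where
  graph := SimpleGraph.fromEdgeSet {e | ∃ h : e ∈ G.edgeSet, b ⟨e, h⟩ = true}
  colour e := col ⟨e, (mem_of_mem_edgeSet_fromEdgeSet e.2).choose⟩

omit [Fintype V] in
theorem mem_edgeSet_colouredOf {c : ℕ} {b : G.edgeSet → Bool} {col : G.edgeSet → Fin c}
    {e : Sym2 V} : e ∈ (colouredOf b col).graph.edgeSet ↔ ∃ h : e ∈ G.edgeSet, b ⟨e, h⟩ = true := by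
  rw [colouredOf, SimpleGraph.edgeSet_fromEdgeSet]
  exact ⟨fun h => h.1, fun h => ⟨h, SimpleGraph.not_isDiag_of_mem_edgeSet _ h.choose⟩⟩

-- Colouring all of `G` and forgetting the colours of discarded edges is the same as colouring
-- retained edges only, by taking a marginal of the product law.
open Classical in
theorem randomColouredSubgraph_eq (G : SimpleGraph V) (p : unitInterval) (c : ℕ) (hc : 0 < c)
    [Nonempty (Fin c)] : randomColouredSubgraph G p c hc =
    (independent fun _ : G.edgeSet => coin p).bind fun b =>
      (independent fun _ : G.edgeSet => PMF.uniformOfFintype (Fin c)).map fun col =>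
        colouredOf b col := by
  unfold randomColouredSubgraph randomSubgraph
  rw [PMF.bind_map]
  congr 1
  funext b
  simp only [Function.comp]
  have h := independent_map_reindex (fun _ : G.edgeSet => PMF.uniformOfFintype (Fin c))
    (fun e : (SimpleGraph.fromEdgeSet {e | ∃ h : e ∈ G.edgeSet, b ⟨e, h⟩ = true}).edgeSet =>
      (⟨e, (mem_of_mem_edgeSet_fromEdgeSet e.2).choose⟩ : G.edgeSet))
    (fun e e' h => Subtype.ext (congrArg (fun e : G.edgeSet => (e : Sym2 V)) h))
  refine (congrArg (PMF.map _) (Eq.trans ?_ h.symm)).trans ((PMF.map_comp _ _ _).trans rfl)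
  congr!

/-- `M` consists of disjoint rainbow sets of retained edges. -/
structure IsGoodFamily {c t : ℕ} (b : G.edgeSet → Bool) (col : G.edgeSet → Fin c)
    (M : Fin t → Finset G.edgeSet) : Prop where
  retained : ∀ i, ∀ e ∈ M i, b e = true
  disjoint : Pairwise fun i j => Disjoint (M i) (M j)
  rainbow : ∀ i, Set.InjOn col (M i)

omit [Fintype V] in
theorem IsGoodFamily.map {c t : ℕ} {b : G.edgeSet → Bool} {col : G.edgeSet → Fin c}
    {M : Fin t → Finset G.edgeSet} (h : IsGoodFamily b col M) (π : Equiv.Perm G.edgeSet) :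
    IsGoodFamily (fun e => b (π.symm e)) (fun e => col (π.symm e))
      fun i => (M i).map π.toEmbedding where
  retained i e he := by
    obtain ⟨e, h1, rfl⟩ := Finset.mem_map.1 he
    simpa using h.retained i e h1
  disjoint i j hij := (Finset.disjoint_map _).2 (h.disjoint hij)
  rainbow i e he e' he' hcol := by
    obtain ⟨e, h1, rfl⟩ := Finset.mem_map.1 he
    obtain ⟨e', h2, rfl⟩ := Finset.mem_map.1 he'
    simp only [Equiv.coe_toEmbedding, Equiv.symm_apply_apply] at hcol ⊢
    rw [h.rainbow i h1 h2 hcol]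

/-- The graphs of the sets in `M`, preceded by the rest of `H`. -/
def splitting {c t : ℕ} (H : ColouredGraph V c) (M : Fin t → Finset G.edgeSet) :
    Fin (t + 1) → SimpleGraph V :=
  Fin.cons (H.graph \ ⨆ i, edgesGraph (M i)) fun i => edgesGraph (M i)

omit [Fintype V] in
theorem IsGoodFamily.isRainbowSplitting {c t : ℕ} {b : G.edgeSet → Bool}
    {col : G.edgeSet → Fin c} {M : Fin t → Finset G.edgeSet} (h : IsGoodFamily b col M) :
    IsRainbowSplitting (colouredOf b col) (splitting (colouredOf b col) M) := by
  have hle : ∀ i, edgesGraph (M i) ≤ (colouredOf b col).graph := by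
    intro i
    rw [← SimpleGraph.edgeSet_subset_edgeSet]
    intro e he
    obtain ⟨he, h1⟩ := mem_edgeSet_edgesGraph.1 he
    exact mem_edgeSet_colouredOf.2 ⟨he, h.retained i _ h1⟩
  have h0 : ∀ i, Disjoint ((colouredOf b col).graph \ ⨆ i, edgesGraph (M i)).edgeSet
      (edgesGraph (M i)).edgeSet := by
    intro i
    rw [SimpleGraph.disjoint_edgeSet]
    exact disjoint_sdiff_self_left.mono_right (le_iSup (fun i => edgesGraph (M i)) i)
  refine ⟨?_, ?_, ?_⟩
  · apply le_antisymm
    · have h1 : (colouredOf b col).graph \ (⨆ i, edgesGraph (M i)) ≤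
          ⨆ i, splitting (colouredOf b col) M i :=
        le_iSup (splitting (colouredOf b col) M) 0
      have h2 : (⨆ i, edgesGraph (M i)) ≤ ⨆ i, splitting (colouredOf b col) M i :=
        iSup_le fun i => le_iSup (splitting (colouredOf b col) M) i.succ
      calc _ ≤ (⨆ i, edgesGraph (M i)) ⊔ ((colouredOf b col).graph \ ⨆ i, edgesGraph (M i)) :=
            le_sup_sdiff
        _ ≤ _ := sup_le h2 h1
    · refine iSup_le fun i => ?_
      cases i using Fin.cases with
      | zero => exact sdiff_le
      | succ i => exact hle i
  · intro i j hij
    cases i using Fin.cases with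
    | zero =>
      cases j using Fin.cases with
      | zero => exact absurd rfl hij
      | succ j => exact h0 j
    | succ i =>
      cases j using Fin.cases with
      | zero => exact (h0 i).symm
      | succ j =>
        change Disjoint (edgesGraph (M i)).edgeSet (edgesGraph (M j)).edgeSet
        rw [Set.disjoint_left]
        intro e he he'
        obtain ⟨h1, h2⟩ := mem_edgeSet_edgesGraph.1 he
        obtain ⟨_, h3⟩ := mem_edgeSet_edgesGraph.1 he'
        exact Finset.disjoint_left.1 (h.disjoint fun hh => hij (congrArg _ hh)) h2 h3
  · intro i hi
    cases i using Fin.cases with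
    | zero => exact absurd rfl hi
    | succ i =>
      intro e f he hf hcol
      obtain ⟨_, h1⟩ := mem_edgeSet_edgesGraph.1 he
      obtain ⟨_, h2⟩ := mem_edgeSet_edgesGraph.1 hf
      exact Subtype.ext (congrArg (fun e : G.edgeSet => (e : Sym2 V)) (h.rainbow i h1 h2 hcol))

/-! ### The coupling and its marginals -/

open Classical in
/-- A good family of `k`-out sets, whenever there is one. -/
def chosenFamily {c : ℕ} (k t : ℕ) (D : Orientation G) (b : G.edgeSet → Bool)
    (col : G.edgeSet → Fin c) : Fin t → KOutSet D k :=
  if h : ∃ M : Fin t → KOutSet D k, IsGoodFamily b col fun i => (M i).1 then h.choose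
  -- The default is still a family of `k`-out sets, so the laws of the `H_i` stay exact when no good
  -- family exists.
  else fun _ => Classical.arbitrary _

theorem isGoodFamily_chosenFamily {c k t : ℕ} {D : Orientation G} {b : G.edgeSet → Bool}
    {col : G.edgeSet → Fin c} (h : ∃ M : Fin t → KOutSet D k, IsGoodFamily b col fun i => (M i).1) :
    IsGoodFamily b col fun i => (chosenFamily k t D b col i).1 := by
  rw [chosenFamily, dif_pos h]
  exact h.choose_spec

/-- The outcome obtained from the chosen family after applying `π`. -/
def outcome {c : ℕ} (k t : ℕ) (D : Orientation G) (b : G.edgeSet → Bool)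
    (col : G.edgeSet → Fin c) (π : tailStabilizer D) :
    ColouredGraph V c × (Fin (t + 1) → SimpleGraph V) :=
  -- The edge `π e` inherits the mark and colour of `e`, so the image of a good family is good for
  -- the new labels.
  let H := colouredOf (fun e => b (π.1.symm e)) fun e => col (π.1.symm e)
  (H, splitting H fun i => ((chosenFamily k t D b col i).image π).1)

open Classical in
/-- Independent uniform orientation, retention marks and colours. -/
def labelling (G : SimpleGraph V) (p : unitInterval) (c : ℕ) [Nonempty (Fin c)] :
    PMF (Orientation G × (G.edgeSet → Bool) × (G.edgeSet → Fin c)) :=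
  (PMF.uniformOfFintype (Orientation G)).bind fun D =>
    (independent fun _ : G.edgeSet => coin p).bind fun b =>
      (independent fun _ : G.edgeSet => PMF.uniformOfFintype (Fin c)).map fun col => (D, b, col)

/-- The joint law of the coloured graph and its splitting. -/
def coupling (G : SimpleGraph V) (p : unitInterval) (c k t : ℕ) [Nonempty (Fin c)] :
    PMF (ColouredGraph V c × (Fin (t + 1) → SimpleGraph V)) :=
  (labelling G p c).bind fun x =>
    (PMF.uniformOfFintype (tailStabilizer x.1)).map (outcome k t x.1 x.2.1 x.2.2)

/-- For each fixed `π` the permuted marks and colours are again i.i.d. with the same laws, so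
averaging over `π` changes nothing. -/
theorem coupling_map_fst (G : SimpleGraph V) (p : unitInterval) (c k t : ℕ) (hc : 0 < c)
    [Nonempty (Fin c)] :
    (coupling G p c k t).map (fun ω => ω.1) = randomColouredSubgraph G p c hc := by
  classical
  rw [randomColouredSubgraph_eq, coupling, labelling]
  simp only [PMF.bind_bind, PMF.map_bind, PMF.bind_map, PMF.map_comp, Function.comp_def, outcome]
  refine Eq.trans ?_ (PMF.bind_const (PMF.uniformOfFintype (Orientation G)) _)
  congr 1
  funext D
  have h : ∀ π : tailStabilizer D, (independent fun _ : G.edgeSet => coin p).bind (fun b =>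
      (independent fun _ : G.edgeSet => PMF.uniformOfFintype (Fin c)).map fun col =>
        colouredOf (fun e => b (π.1.symm e)) (fun e => col (π.1.symm e))) =
      (independent fun _ : G.edgeSet => coin p).bind fun b =>
      (independent fun _ : G.edgeSet => PMF.uniformOfFintype (Fin c)).map fun col =>
        colouredOf b col := by
    intro π
    conv_rhs =>
      rw [← independent_map_reindex (fun _ : G.edgeSet => coin p) π.1.symm π.1.symm.injective,
        PMF.bind_map,
        ← independent_map_reindex (fun _ : G.edgeSet => PMF.uniformOfFintype (Fin c)) π.1.symm
          π.1.symm.injective]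
    simp only [PMF.map_comp, Function.comp_def]
  refine Eq.trans ?_ (PMF.bind_const (PMF.uniformOfFintype (tailStabilizer D)) _)
  symm
  rw [← funext h, PMF.bind_comm]
  congr 1
  funext b
  simp only [← PMF.bind_pure_comp, Function.comp_def]
  exact PMF.bind_comm _ _ _

/-- Conditionally on orientation, marks and colours the chosen set is fixed, and its image under a
random `π` is uniform by `uniform_map_image`. -/
theorem coupling_map_snd (G : SimpleGraph V) (p : unitInterval) (c k t : ℕ) [Nonempty (Fin c)]
    (i : Fin (t + 1)) (hi : i ≠ 0) :
    (coupling G p c k t).map (fun ω => ω.2 i) = randomKOutStar G k := by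
  classical
  obtain ⟨i, rfl⟩ := Fin.exists_succ_eq.2 hi
  rw [randomKOutStar_eq, coupling, labelling]
  simp only [PMF.bind_bind, PMF.map_bind, PMF.bind_map, PMF.map_comp, Function.comp_def]
  congr 1
  funext D
  refine Eq.trans ?_ (PMF.bind_const (independent fun _ : G.edgeSet => coin p) _)
  congr 1
  funext b
  refine Eq.trans ?_
    (PMF.bind_const (independent fun _ : G.edgeSet => PMF.uniformOfFintype (Fin c)) _)
  congr 1
  funext col
  rw [← uniform_map_image (chosenFamily k t D b col i), PMF.map_comp]
  rfl

theorem toOuterMeasure_bind_le {α β : Type} (P : PMF α) (Q : α → PMF β) (s : Set β) (B : Set α)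
    (h : ∀ a ∉ B, (Q a).toOuterMeasure s = 0) :
    (P.bind Q).toOuterMeasure s ≤ P.toOuterMeasure B := by
  rw [PMF.toOuterMeasure_bind_apply, PMF.toOuterMeasure_apply]
  refine ENNReal.tsum_le_tsum fun a => ?_
  by_cases ha : a ∈ B
  · rw [Set.indicator_of_mem ha]
    refine mul_le_of_le_one_right' ?_
    rw [PMF.toOuterMeasure_apply]
    exact (ENNReal.tsum_le_tsum fun b => Set.indicator_le_self _ _ b).trans (Q a).tsum_coe.le
  · simp [h a ha]

theorem coupling_not_isRainbowSplitting_le (G : SimpleGraph V) (p : unitInterval) (c k t : ℕ)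
    [Nonempty (Fin c)] :
    (coupling G p c k t).toOuterMeasure {ω | IsRainbowSplitting ω.1 ω.2}ᶜ ≤
      (labelling G p c).toOuterMeasure
        {x | ¬ ∃ M : Fin t → KOutSet x.1 k, IsGoodFamily x.2.1 x.2.2 fun i => (M i).1} := by
  refine toOuterMeasure_bind_le _ _ _ _ fun x hx => ?_
  simp only [Set.mem_ofPred_eq, not_not] at hx
  rw [PMF.toOuterMeasure_map_apply]
  refine Eq.trans (congrArg _ ?_)
    (MeasureTheory.measure_empty (μ := (PMF.uniformOfFintype (tailStabilizer x.1)).toOuterMeasure))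
  ext π
  simp only [Set.mem_preimage, Set.mem_compl_iff, Set.mem_ofPred_eq, Set.mem_empty_iff_false,
    iff_false, not_not]
  exact ((isGoodFamily_chosenFamily hx).map π.1).isRainbowSplitting

open Classical in
theorem exists_isGoodFamily {c k t : ℕ} (D : Orientation G) (b : G.edgeSet → Bool)
    (col : G.edgeSet → Fin c) (hc : c = k * Fintype.card V)
    (hcut : ∀ (S : Finset V) (T : Finset (Fin c)), t * (k * S.card + T.card) ≤ t * c +
      (Finset.univ.filter fun e => b e = true ∧ (D e : V) ∈ S ∧ col e ∈ T).card) :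
    ∃ M : Fin t → KOutSet D k, IsGoodFamily b col fun i => (M i).1 := by
  obtain ⟨M, h1, h2, h3, h4⟩ := exists_rainbow_decomposition (fun e => (D e : V)) col
    (Finset.univ.filter fun e => b e = true) k t (by simpa using hc)
    (fun S T => by simpa [Finset.filter_filter] using hcut S T)
  refine ⟨fun i => ⟨M i, fun v => ?_⟩, ?_, h2, h4⟩
  -- Having `k` chosen edges with tail `v` forces the out-degree of `v` to be at least `k`.
  · rw [h3, min_eq_left]
    rw [← h3 i v]
    exact Finset.card_le_card (Finset.filter_subset_filter _ (Finset.subset_univ _))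
  · intro i e he
    simpa using h1 i he

/-! ### Chernoff bound for a single cut -/

theorem tsum_bind_mul {α β : Type} (P : PMF α) (Q : α → PMF β) (f : β → ℝ≥0∞) :
    ∑' x, P.bind Q x * f x = ∑' a, P a * ∑' x, Q a x * f x := by
  simp only [PMF.bind_apply, ← ENNReal.tsum_mul_right, ← ENNReal.tsum_mul_left, mul_assoc]
  exact ENNReal.tsum_comm

theorem tsum_map_mul {α β : Type} (P : PMF α) (g : α → β) (f : β → ℝ≥0∞) :
    ∑' x, P.map g x * f x = ∑' a, P a * f (g a) := by
  rw [← PMF.bind_pure_comp, tsum_bind_mul]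
  refine tsum_congr fun a => ?_
  congr 1
  rw [tsum_eq_single (g a)]
  · simp
  · intro b hb
    simp [PMF.pure_apply, hb]

theorem sum_pmf_mul_ite {α : Type} [Fintype α] (P : PMF α) (q : α → Prop) [DecidablePred q] {y : ℝ} (hy : 0 ≤ y) :
    ∑ a, P a * (if q a then ENNReal.ofReal y else 1) =
      ENNReal.ofReal (1 - (1 - y) * ∑ a with q a, (P a).toReal) := by
  have h1 := sum_pmf P
  rw [← Finset.sum_filter_add_sum_filter_not Finset.univ q] at h1 ⊢
  rw [Finset.sum_congr (g := fun a => P a * ENNReal.ofReal y) rfl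
      (fun a ha => by rw [if_pos (Finset.mem_filter.1 ha).2]),
    Finset.sum_congr (s₁ := Finset.univ.filter fun a => ¬ q a) (g := fun a => P a) rfl
      (fun a ha => by rw [if_neg (Finset.mem_filter.1 ha).2, mul_one]), ← Finset.sum_mul]
  have hA : ∑ a with q a, P a = ENNReal.ofReal (∑ a with q a, (P a).toReal) := by
    rw [ENNReal.ofReal_sum_of_nonneg fun _ _ => ENNReal.toReal_nonneg]
    exact Finset.sum_congr rfl fun a _ => (ENNReal.ofReal_toReal (P.apply_ne_top a)).symm
  have hB : ∑ a with ¬ q a, P a = ENNReal.ofReal (∑ a with ¬ q a, (P a).toReal) := by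
    rw [ENNReal.ofReal_sum_of_nonneg fun _ _ => ENNReal.toReal_nonneg]
    exact Finset.sum_congr rfl fun a _ => (ENNReal.ofReal_toReal (P.apply_ne_top a)).symm
  rw [hA, hB] at h1 ⊢
  have hA0 : 0 ≤ ∑ a with q a, (P a).toReal := Finset.sum_nonneg fun _ _ => ENNReal.toReal_nonneg
  have hB0 : 0 ≤ ∑ a with ¬ q a, (P a).toReal := Finset.sum_nonneg fun _ _ => ENNReal.toReal_nonneg
  rw [← ENNReal.ofReal_add hA0 hB0, ENNReal.ofReal_eq_one] at h1
  rw [← ENNReal.ofReal_mul hA0, ← ENNReal.ofReal_add (mul_nonneg hA0 hy) hB0]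
  congr 1
  linear_combination h1

-- Tail, mark and colour are independent over the edges, so the expectation of an edgewise product
-- factorises.
open Classical in
theorem tsum_labelling_mul_prod (p : unitInterval) (c : ℕ) [Nonempty (Fin c)]
    (g : ∀ e : G.edgeSet, {v : V // v ∈ (e : Sym2 V)} → Bool → Fin c → ℝ≥0∞) :
    ∑' x, labelling G p c x * ∏ e, g e (x.1 e) (x.2.1 e) (x.2.2 e) =
      ∏ e : G.edgeSet, ∑ τ, (@PMF.uniformOfFintype {v : V // v ∈ (e : Sym2 V)} _
        ⟨(e : Sym2 V).out.1, Sym2.out_fst_mem _⟩) τ * ∑ β, coin p β *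
          ∑ γ, PMF.uniformOfFintype (Fin c) γ * g e τ β γ := by
  have : ∀ e : G.edgeSet, Nonempty {v : V // v ∈ (e : Sym2 V)} := fun e =>
    ⟨(e : Sym2 V).out.1, Sym2.out_fst_mem _⟩
  have h0 : ∀ (D : Orientation G) (F : Orientation G × (G.edgeSet → Bool) × (G.edgeSet → Fin c) →
      ℝ≥0∞), ∑' x, ((independent fun _ : G.edgeSet => coin p).bind fun b =>
        (independent fun _ : G.edgeSet => PMF.uniformOfFintype (Fin c)).map fun col =>
          (D, b, col)) x * F x =
      ∑ b, (independent fun _ : G.edgeSet => coin p) b *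
        ∑ col, (independent fun _ : G.edgeSet => PMF.uniformOfFintype (Fin c)) col *
          F (D, b, col) := by
    intro D F
    rw [tsum_bind_mul, tsum_fintype]
    refine Finset.sum_congr rfl fun b _ => ?_
    rw [tsum_map_mul, tsum_fintype]
  rw [labelling, tsum_bind_mul, tsum_fintype]
  refine (Finset.sum_congr rfl fun D _ => congrArg _ (h0 D _)).trans ?_
  have h1 : ∀ (D : Orientation G) (b : G.edgeSet → Bool), ∑ col,
      (independent fun _ : G.edgeSet => PMF.uniformOfFintype (Fin c)) col *
        ∏ e, g e (D e) (b e) (col e) =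
      ∏ e, ∑ γ, PMF.uniformOfFintype (Fin c) γ * g e (D e) (b e) γ := fun D b =>
    sum_independent_mul_prod _ fun e γ => g e (D e) (b e) γ
  simp only [h1]
  have h2 : ∀ D : Orientation G, ∑ b, (independent fun _ : G.edgeSet => coin p) b *
        ∏ e, ∑ γ, PMF.uniformOfFintype (Fin c) γ * g e (D e) (b e) γ =
      ∏ e, ∑ β, coin p β * ∑ γ, PMF.uniformOfFintype (Fin c) γ * g e (D e) β γ := fun D =>
    sum_independent_mul_prod _ fun e β =>
      ∑ γ, PMF.uniformOfFintype (Fin c) γ * g e (D e) β γ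
  simp only [h2]
  rw [show PMF.uniformOfFintype (Orientation G) = independent fun e : G.edgeSet =>
    PMF.uniformOfFintype {v : V // v ∈ (e : Sym2 V)} from uniformOfFintype_pi]
  exact sum_independent_mul_prod _ fun e τ =>
    ∑ β, coin p β * ∑ γ, PMF.uniformOfFintype (Fin c) γ * g e τ β γ

open Classical in
/-- The number of retained edges with tail in `S` and colour in `T`. -/
def cutCount {c : ℕ} (S : Finset V) (T : Finset (Fin c))
    (x : Orientation G × (G.edgeSet → Bool) × (G.edgeSet → Fin c)) : ℕ :=
  (Finset.univ.filter fun e => x.2.1 e = true ∧ (x.1 e : V) ∈ S ∧ x.2.2 e ∈ T).card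

open Classical in
theorem card_mem_edge (e : G.edgeSet) : Fintype.card {v : V // v ∈ (e : Sym2 V)} = 2 := by
  obtain ⟨e, he⟩ := e
  induction e with
  | _ u v =>
    rw [Fintype.card_subtype]
    have : (Finset.univ.filter fun w => w ∈ s(u, v)) = {u, v} := by
      ext w
      simp
    rw [this, Finset.card_pair (G.mem_edgeSet.1 he).ne]

-- An edge `e` counts with probability `|e ∩ S|/2 * p * |T|/c`. Each factor is bounded by `1 + x ≤
-- exp x`, and summing `|e ∩ S|` over edges gives the degree sum over `S`.
open Classical in
theorem labelling_moment (p : unitInterval) (c : ℕ) [Nonempty (Fin c)] (S : Finset V)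
    (T : Finset (Fin c)) {y : ℝ} (hy : 0 ≤ y) :
    ∑' x, labelling G p c x * ENNReal.ofReal (y ^ cutCount S T x) ≤
      ENNReal.ofReal (Real.exp (-((1 - y) * (p * (T.card / c)) / 2 *
        ∑ v ∈ S, ((Finset.univ.filter fun e : G.edgeSet => v ∈ (e : Sym2 V)).card : ℝ)))) := by
  have hg : ∀ x : Orientation G × (G.edgeSet → Bool) × (G.edgeSet → Fin c),
      ENNReal.ofReal (y ^ cutCount S T x) = ∏ e, if (x.1 e : V) ∈ S then
        (if x.2.1 e = true then (if x.2.2 e ∈ T then ENNReal.ofReal y else 1) else 1) else 1 := by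
    intro x
    rw [cutCount, ← Finset.prod_const, Finset.prod_filter,
      ENNReal.ofReal_prod_of_nonneg fun e _ => by split_ifs <;> first | exact hy | exact zero_le_one]
    refine Finset.prod_congr rfl fun e _ => ?_
    split_ifs <;> simp_all
  have hc0 : (0 : ℝ) < c := by
    rw [Nat.cast_pos]
    exact Fin.pos_iff_nonempty.2 inferInstance
  have hT : (T.card : ℝ) / c ≤ 1 := by
    rw [div_le_one hc0]
    exact_mod_cast (Finset.card_le_univ T).trans_eq (Fintype.card_fin c)
  have hT0 : (0 : ℝ) ≤ T.card / c := by positivity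
  have hw0 : 0 ≤ (p : ℝ) * (T.card / c) := mul_nonneg p.2.1 hT0
  have hw1 : (p : ℝ) * (T.card / c) ≤ 1 := mul_le_one₀ p.2.2 hT0 hT
  simp only [hg]
  refine (le_of_eq (tsum_labelling_mul_prod p c
    fun (e : G.edgeSet) (τ : {v : V // v ∈ (e : Sym2 V)}) β γ => if (τ : V) ∈ S then
      (if β = true then (if γ ∈ T then ENNReal.ofReal y else 1) else 1) else 1)).trans ?_
  have hγ : ∑ γ : Fin c, PMF.uniformOfFintype (Fin c) γ * (if γ ∈ T then ENNReal.ofReal y else 1) =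
      ENNReal.ofReal (1 - (1 - y) * (T.card / c)) := by
    rw [sum_pmf_mul_ite _ (fun γ => γ ∈ T) hy]
    simp [div_eq_mul_inv]
  have hy1' : 0 ≤ 1 - (1 - y) * (T.card / c : ℝ) := by nlinarith
  have hβ : ∑ β, coin p β * (∑ γ : Fin c, PMF.uniformOfFintype (Fin c) γ *
      if β = true then (if γ ∈ T then ENNReal.ofReal y else 1) else 1) =
      ENNReal.ofReal (1 - (1 - y) * (p * (T.card / c))) := by
    have : ∀ β, (∑ γ : Fin c, PMF.uniformOfFintype (Fin c) γ *
        if β = true then (if γ ∈ T then ENNReal.ofReal y else 1) else 1) =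
        if β = true then ENNReal.ofReal (1 - (1 - y) * (T.card / c)) else 1 := by
      intro β
      split_ifs
      · exact hγ
      · simp only [mul_one]
        exact sum_pmf _
    simp only [this]
    rw [sum_pmf_mul_ite _ (fun β => β = true) hy1']
    have hp : (coin p true).toReal = p := by simp [coin, p.2.1]
    rw [Finset.sum_filter, Fintype.sum_bool]
    simp only [hp, if_true, Bool.false_eq_true, if_false]
    congr 1
    ring
  have hy2' : 0 ≤ 1 - (1 - y) * (p * (T.card / c) : ℝ) := by nlinarith
  have hτ : ∀ e : G.edgeSet, (∑ τ, (@PMF.uniformOfFintype {v : V // v ∈ (e : Sym2 V)} _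
        ⟨(e : Sym2 V).out.1, Sym2.out_fst_mem _⟩) τ * ∑ β, coin p β *
          ∑ γ, PMF.uniformOfFintype (Fin c) γ * if (τ : V) ∈ S then
        (if β = true then (if γ ∈ T then ENNReal.ofReal y else 1) else 1) else 1) ≤
      ENNReal.ofReal (Real.exp (-((1 - y) * (p * (T.card / c)) / 2 *
        (S.filter fun v => v ∈ (e : Sym2 V)).card))) := by
    intro e
    have : ∀ τ : {v : V // v ∈ (e : Sym2 V)}, (∑ β, coin p β *
        ∑ γ, PMF.uniformOfFintype (Fin c) γ * if (τ : V) ∈ S then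
        (if β = true then (if γ ∈ T then ENNReal.ofReal y else 1) else 1) else 1) =
        if (τ : V) ∈ S then ENNReal.ofReal (1 - (1 - y) * (p * (T.card / c))) else 1 := by
      intro τ
      split_ifs
      · exact hβ
      · simp only [mul_one, sum_pmf]
    simp only [this]
    rw [sum_pmf_mul_ite _ (fun τ : {v : V // v ∈ (e : Sym2 V)} => (τ : V) ∈ S) hy2']
    apply ENNReal.ofReal_le_ofReal
    have hcard : (Finset.univ.filter fun τ : {v : V // v ∈ (e : Sym2 V)} => (τ : V) ∈ S).card =
        (S.filter fun v => v ∈ (e : Sym2 V)).card := by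
      rw [← Finset.card_map (Function.Embedding.subtype _)]
      congr 1
      ext v
      simp [and_comm]
    simp only [PMF.uniformOfFintype_apply, Finset.sum_const, hcard, card_mem_edge]
    refine le_trans (le_of_eq ?_) (Real.add_one_le_exp _)
    simp
    ring
  refine (Finset.prod_le_prod' fun e _ => hτ e).trans_eq ?_
  rw [← ENNReal.ofReal_prod_of_nonneg fun _ _ => (Real.exp_pos _).le, ← Real.exp_sum,
    Finset.sum_neg_distrib, ← Finset.mul_sum]
  congr 4
  rw [← Nat.cast_sum, ← Nat.cast_sum]
  congr 1
  simp only [Finset.card_filter]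
  exact Finset.sum_comm

-- Markov's inequality for `y ^ cutCount` with `y = exp (-η)`. Since `1 - y ≥ η - η²/2`, the
-- exponent is at most `η(1 - η)M - (η - η²/2)M = -η²M/2`.
open Classical in
theorem labelling_cutCount_lt_le (p : unitInterval) (c : ℕ) [Nonempty (Fin c)] (S : Finset V)
    (T : Finset (Fin c)) (δ : ℕ)
    (hδ : ∀ v, δ ≤ (Finset.univ.filter fun e : G.edgeSet => v ∈ (e : Sym2 V)).card)
    {η L M : ℝ} (hη : 0 < η) (hM : M = p * δ * S.card * T.card / (2 * c))
    (hL : L ≤ (1 - η) * M) :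
    (labelling G p c).toOuterMeasure {x | (cutCount S T x : ℝ) ≤ L} ≤
      ENNReal.ofReal (Real.exp (-(η ^ 2 * M / 2))) := by
  set y := Real.exp (-η) with hy
  have hy1 : y ≤ 1 := Real.exp_le_one_iff.2 (by linarith)
  have hM0 : 0 ≤ M := by
    have := p.2.1
    rw [hM]
    positivity
  have hmarkov : (labelling G p c).toOuterMeasure {x | (cutCount S T x : ℝ) ≤ L} ≤
      ENNReal.ofReal (Real.exp (η * L)) *
        ∑' x, labelling G p c x * ENNReal.ofReal (y ^ cutCount S T x) := by
    rw [PMF.toOuterMeasure_apply, ← ENNReal.tsum_mul_left]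
    refine ENNReal.tsum_le_tsum fun x => ?_
    rw [Set.indicator_apply]
    split_ifs with hx
    · rw [mul_left_comm, ← ENNReal.ofReal_mul (Real.exp_pos _).le]
      refine le_mul_of_one_le_right' ?_
      rw [ENNReal.one_le_ofReal, hy, ← Real.exp_nat_mul, ← Real.exp_add, Real.one_le_exp_iff]
      have : (cutCount S T x : ℝ) ≤ L := hx
      nlinarith
    · exact zero_le
  refine hmarkov.trans ?_
  refine (mul_le_mul_right (labelling_moment p c S T (Real.exp_pos _).le) _).trans ?_
  rw [← ENNReal.ofReal_mul (Real.exp_pos _).le, ← Real.exp_add]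
  apply ENNReal.ofReal_le_ofReal
  apply Real.exp_le_exp.2
  have hsum : (δ : ℝ) * S.card ≤
      ∑ v ∈ S, ((Finset.univ.filter fun e : G.edgeSet => v ∈ (e : Sym2 V)).card : ℝ) := by
    rw [mul_comm, ← nsmul_eq_mul, ← Finset.sum_const]
    exact Finset.sum_le_sum fun v _ => by exact_mod_cast hδ v
  have hyη : η - η ^ 2 / 2 ≤ 1 - y := by
    have := Real.quadratic_le_exp_of_nonneg hη.le
    have h2 : y * Real.exp η = 1 := by rw [hy, ← Real.exp_add]; simp
    have h3 : 0 < y := Real.exp_pos _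
    nlinarith [mul_le_mul_of_nonneg_left this h3.le, mul_pos hη hη, pow_pos hη 3, pow_pos hη 4]
  have h1 : (1 - y) * (p * (T.card / c)) / 2 * (δ * S.card) = (1 - y) * M := by
    rw [hM]
    ring
  have h2 : (1 - y) * (p * (T.card / c)) / 2 * (δ * S.card) ≤
      (1 - y) * (p * (T.card / c)) / 2 * ∑ v ∈ S,
        ((Finset.univ.filter fun e : G.edgeSet => v ∈ (e : Sym2 V)).card : ℝ) := by
    refine mul_le_mul_of_nonneg_left hsum ?_
    have := p.2.1
    have : 0 ≤ 1 - y := by linarith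
    positivity
  have h3 := mul_le_mul_of_nonneg_right hyη hM0
  have h4 := mul_le_mul_of_nonneg_left hL hη.le
  linarith

/-! ### Union bound over all cuts -/

-- The bound is a sum of products of a function of `S` and a function of `T`, so that it sums over
-- all cuts by the binomial theorem. The subtracted indicators remove the empty set, where no cut
-- fails; without them the total would not tend to zero.
open Classical in
theorem labelling_cut_failure_le (p : unitInterval) {c k t δ : ℕ} [Nonempty (Fin c)]
    (hk : 0 < k) (hc : c = k * Fintype.card V)
    (hδ : ∀ v, δ ≤ (Finset.univ.filter fun e : G.edgeSet => v ∈ (e : Sym2 V)).card)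
    {η d : ℝ} (hη : 0 < η) (hη1 : η ≤ 1) (hd : d = δ * p / (2 * k)) (ht : (t : ℝ) ≤ (1 - η) * d)
    (S : Finset V) (T : Finset (Fin c)) :
    (labelling G p c).toOuterMeasure
        {x | t * c + cutCount S T x < t * (k * S.card + T.card)} ≤
      ENNReal.ofReal
        (Real.exp (-(η ^ 2 * d / 8)) ^ (Fintype.card V - S.card) *
          (Real.exp (-(η ^ 2 * d / 8)) ^ T.card - if T = ∅ then 1 else 0) +
        (Real.exp (-(η ^ 2 * d / 8)) ^ S.card - if S = ∅ then 1 else 0) *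
          Real.exp (-(η ^ 2 * d / 8)) ^ (c - T.card)) := by
  have hd0 : 0 ≤ d := by
    have := p.2.1
    rw [hd]
    positivity
  have hs : S.card ≤ Fintype.card V := Finset.card_le_univ S
  have hr : T.card ≤ c := (Finset.card_le_univ T).trans_eq (Fintype.card_fin c)
  have hc0 : 0 < c := Fin.pos_iff_nonempty.2 inferInstance
  rcases le_or_gt (k * S.card + T.card) c with hle | hgt
  · have : {x : Orientation G × (G.edgeSet → Bool) × (G.edgeSet → Fin c) |
        t * c + cutCount S T x < t * (k * S.card + T.card)} = ∅ := by
      rw [Set.eq_empty_iff_forall_notMem]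
      intro x hx
      have h1 := Nat.mul_le_mul_left t hle
      have h2 : t * c + cutCount S T x < t * (k * S.card + T.card) := hx
      omega
    rw [this, MeasureTheory.measure_empty]
    exact zero_le
  have hks : k * S.card ≤ c := hc ▸ Nat.mul_le_mul_left k hs
  have hS : S ≠ ∅ := by
    rintro rfl
    simp at hgt
    omega
  have hT : T ≠ ∅ := by
    rintro rfl
    simp at hgt
    omega
  rw [if_neg hS, if_neg hT, sub_zero, sub_zero, ← pow_add, ← pow_add]
  have hc0' : (0 : ℝ) < c := by exact_mod_cast hc0
  have hks' : (k : ℝ) * S.card ≤ c := by exact_mod_cast hks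
  have hr' : (T.card : ℝ) ≤ c := by exact_mod_cast hr
  have hgt' : (c : ℝ) < k * S.card + T.card := by exact_mod_cast hgt
  have hk' : (1 : ℝ) ≤ k := by exact_mod_cast hk
  have hcn : (c : ℝ) = k * Fintype.card V := by exact_mod_cast hc
  have hs' : (S.card : ℝ) ≤ Fintype.card V := by exact_mod_cast hs
  set M : ℝ := d * (k * S.card * T.card / c) with hM
  have hbound := labelling_cutCount_lt_le p c S T δ hδ hη (M := M)
    (L := t * (k * S.card + T.card - c)) (by rw [hM, hd]; field_simp) (by
      -- This is `(c - k|S|)(c - |T|) ≥ 0`.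
      have h1 : (k * S.card + T.card - c : ℝ) ≤ k * S.card * T.card / c := by
        rw [le_div_iff₀ hc0']
        nlinarith
      calc (t : ℝ) * (k * S.card + T.card - c)
          ≤ ((1 - η) * d) * (k * S.card + T.card - c) :=
            mul_le_mul_of_nonneg_right ht (by linarith)
        _ ≤ ((1 - η) * d) * (k * S.card * T.card / c) :=
            mul_le_mul_of_nonneg_left h1 (mul_nonneg (by linarith) hd0)
        _ = (1 - η) * M := by rw [hM]; ring)
  refine (MeasureTheory.measure_mono ?_).trans (hbound.trans (ENNReal.ofReal_le_ofReal ?_))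
  · intro x hx
    have hx' : t * c + cutCount S T x < t * (k * S.card + T.card) := hx
    have : (t * c + cutCount S T x : ℝ) < t * (k * S.card + T.card) := by exact_mod_cast hx'
    change (cutCount S T x : ℝ) ≤ _
    linarith
  · have key : ∀ m : ℕ, d * m / 4 ≤ M →
        Real.exp (-(η ^ 2 * M / 2)) ≤ Real.exp (-(η ^ 2 * d / 8)) ^ m := by
      intro m hm
      rw [← Real.exp_nat_mul]
      apply Real.exp_le_exp.2
      nlinarith [mul_le_mul_of_nonneg_left hm (sq_nonneg η)]
    -- As `k|S| + |T| > c`, the larger of the two exceeds `c/2`, so `M` is at least `d/2` times the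
    -- smaller. Moreover `n - |S| ≤ c - k|S| < |T|` and `c - |T| < k|S|`, which bounds the exponents
    -- by twice the smaller one.
    rcases le_total (T.card : ℝ) (k * S.card) with h | h
    · refine (key _ ?_).trans (le_add_of_nonneg_right (by positivity))
      have h1 : (T.card : ℝ) / 2 ≤ k * S.card * T.card / c := by
        rw [le_div_iff₀ hc0']
        nlinarith
      have h2 : ((Fintype.card V - S.card + T.card : ℕ) : ℝ) ≤ 2 * T.card := by
        push_cast [hs]
        nlinarith
      rw [hM, mul_div_assoc]
      exact mul_le_mul_of_nonneg_left (by linarith) hd0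
    · refine (key _ ?_).trans (le_add_of_nonneg_left (by positivity))
      have h1 : (k * S.card : ℝ) / 2 ≤ k * S.card * T.card / c := by
        rw [le_div_iff₀ hc0']
        have : (0 : ℝ) ≤ k * S.card := by positivity
        nlinarith
      have h2 : ((S.card + (c - T.card) : ℕ) : ℝ) ≤ 2 * (k * S.card) := by
        push_cast [hr]
        have : (0 : ℝ) ≤ S.card := by positivity
        nlinarith
      rw [hM, mul_div_assoc]
      exact mul_le_mul_of_nonneg_left (by linarith) hd0

theorem sum_pow_card_sub {α : Type} [Fintype α] [∀ S : Finset α, Decidable (S = ∅)] (q : ℝ) :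
    ∑ S : Finset α, (q ^ S.card - if S = ∅ then 1 else 0) = (1 + q) ^ Fintype.card α - 1 := by
  rw [Finset.sum_sub_distrib, Finset.sum_eq_single_of_mem ∅ (Finset.mem_univ _)
    (fun S _ h => if_neg h), if_pos rfl, add_comm 1 q, ← Fintype.sum_pow_mul_eq_add_pow]
  simp

theorem sum_pow_sub_card {α : Type} [Fintype α] (q : ℝ) :
    ∑ S : Finset α, q ^ (Fintype.card α - S.card) = (1 + q) ^ Fintype.card α := by
  rw [← Fintype.sum_pow_mul_eq_add_pow]
  simp

open Classical in
theorem coupling_failure_le (p : unitInterval) {c k t δ : ℕ} [Nonempty (Fin c)]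
    (hk : 0 < k) (hc : c = k * Fintype.card V)
    (hδ : ∀ v, δ ≤ (Finset.univ.filter fun e : G.edgeSet => v ∈ (e : Sym2 V)).card)
    {η d : ℝ} (hη : 0 < η) (hη1 : η ≤ 1) (hd : d = δ * p / (2 * k)) (ht : (t : ℝ) ≤ (1 - η) * d) :
    (coupling G p c k t).toOuterMeasure {ω | IsRainbowSplitting ω.1 ω.2}ᶜ ≤
      ENNReal.ofReal (2 * (1 + Real.exp (-(η ^ 2 * d / 8))) ^ c *
        ((1 + Real.exp (-(η ^ 2 * d / 8))) ^ c - 1)) := by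
  set q := Real.exp (-(η ^ 2 * d / 8)) with hq
  have hq0 : 0 < q := Real.exp_pos _
  have hn : Fintype.card V ≤ c := hc ▸ Nat.le_mul_of_pos_left _ hk
  have hsub : {x : Orientation G × (G.edgeSet → Bool) × (G.edgeSet → Fin c) |
      ¬ ∃ M : Fin t → KOutSet x.1 k, IsGoodFamily x.2.1 x.2.2 fun i => (M i).1} ⊆
      ⋃ i ∈ (Finset.univ : Finset (Finset V × Finset (Fin c))),
        {x | t * c + cutCount i.1 i.2 x < t * (k * i.1.card + i.2.card)} := by
    intro x hx
    by_contra h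
    refine hx (exists_isGoodFamily x.1 x.2.1 x.2.2 hc fun S T => ?_)
    by_contra h'
    exact h (Set.mem_iUnion₂.2 ⟨(S, T), Finset.mem_univ _, lt_of_not_ge h'⟩)
  refine (coupling_not_isRainbowSplitting_le G p c k t).trans
    ((MeasureTheory.measure_mono hsub).trans
      ((MeasureTheory.measure_biUnion_finset_le _ _).trans
        ((Finset.sum_le_sum fun i _ =>
          labelling_cut_failure_le p hk hc hδ hη hη1 hd ht i.1 i.2).trans ?_)))
  have hnn : ∀ {α : Type} [∀ U : Finset α, Decidable (U = ∅)] (U : Finset α), 0 ≤ q ^ U.card - if U = ∅ then (1 : ℝ) else 0 := by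
    intro α _ U
    split_ifs with h
    · simp [h]
    · rw [sub_zero]
      positivity
  rw [← hq, ← ENNReal.ofReal_sum_of_nonneg fun i _ => add_nonneg
    (mul_nonneg (by positivity) (hnn i.2)) (mul_nonneg (hnn i.1) (by positivity))]
  apply ENNReal.ofReal_le_ofReal
  have e := sum_pow_sub_card (α := Fin c) q
  rw [Fintype.card_fin] at e
  rw [Finset.sum_add_distrib, Fintype.sum_prod_type, Fintype.sum_prod_type]
  have hprod : ∀ (f : Finset V → ℝ) (g : Finset (Fin c) → ℝ),
      ∑ S, ∑ T, f S * g T = (∑ S, f S) * ∑ T, g T := fun f g =>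
    (Finset.sum_mul_sum _ _ _ _).symm
  rw [hprod (fun S => q ^ (Fintype.card V - S.card)) fun T => q ^ T.card - if T = ∅ then 1 else 0,
    hprod (fun S => q ^ S.card - if S = ∅ then 1 else 0) fun T => q ^ (c - T.card)]
  rw [sum_pow_sub_card, e, sum_pow_card_sub, sum_pow_card_sub,
    Fintype.card_fin]
  have h1 : (1 + q) ^ Fintype.card V ≤ (1 + q) ^ c := pow_le_pow_right₀ (by linarith) hn
  have h2 : 1 ≤ (1 + q) ^ c := one_le_pow₀ (by linarith)
  have h3 : 1 ≤ (1 + q) ^ Fintype.card V := one_le_pow₀ (by linarith)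
  nlinarith

/-- The bound of `coupling_failure_le` tends to zero if `d` grows faster than `log n`. -/
theorem tendsto_failure_bound (k : ℕ) {a : ℝ} (ha : 0 < a) (d : ℕ → ℝ)
    (hd : (fun n : ℕ => Real.log n) =o[atTop] d) (hd0 : ∀ n, 0 ≤ d n) :
    Tendsto (fun n => 2 * (1 + Real.exp (-(a * d n))) ^ (k * n) *
      ((1 + Real.exp (-(a * d n))) ^ (k * n) - 1)) atTop (𝓝 0) := by
  -- The factor 2 gives `exp (-(a * d n)) ≤ n⁻²`, whence the power is at most `exp (k / n)`.
  have h1 : ∀ᶠ n : ℕ in atTop, 2 * Real.log n ≤ a * d n := by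
    filter_upwards [hd.bound (half_pos ha), eventually_ge_atTop 1] with n hn hn1
    rw [Real.norm_of_nonneg (Real.log_natCast_nonneg n), Real.norm_of_nonneg (hd0 n)] at hn
    linarith
  have hlim : Tendsto (fun n : ℕ => (k : ℝ) / n) atTop (𝓝 0) :=
    tendsto_const_div_atTop_nhds_zero_nat _
  have hexp : Tendsto (fun n : ℕ => Real.exp ((k : ℝ) / n)) atTop (𝓝 1) := by
    simpa [Function.comp_def] using (Real.continuous_exp.tendsto 0).comp hlim
  have hpow : Tendsto (fun n => (1 + Real.exp (-(a * d n))) ^ (k * n)) atTop (𝓝 1) := by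
    refine tendsto_of_tendsto_of_tendsto_of_le_of_le' tendsto_const_nhds hexp ?_ ?_
    · exact Eventually.of_forall fun n => one_le_pow₀ (by linarith [Real.exp_pos (-(a * d n))])
    · filter_upwards [h1, eventually_ge_atTop 1] with n hn hn1
      have hn0 : (0 : ℝ) < n := by exact_mod_cast hn1
      have hq : Real.exp (-(a * d n)) ≤ ((n : ℝ) ^ 2)⁻¹ := by
        rw [← Real.exp_log (by positivity : (0 : ℝ) < ((n : ℝ) ^ 2)⁻¹), Real.log_inv,
          Real.log_pow]
        apply Real.exp_le_exp.2
        push_cast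
        linarith
      calc (1 + Real.exp (-(a * d n))) ^ (k * n)
          ≤ Real.exp (Real.exp (-(a * d n))) ^ (k * n) := by
            refine pow_le_pow_left₀ (by positivity) ?_ _
            linarith [Real.add_one_le_exp (Real.exp (-(a * d n)))]
        _ = Real.exp ((k * n : ℕ) * Real.exp (-(a * d n))) := (Real.exp_nat_mul _ _).symm
        _ ≤ Real.exp ((k : ℝ) / n) := by
            apply Real.exp_le_exp.2
            calc ((k * n : ℕ) : ℝ) * Real.exp (-(a * d n)) ≤ ((k * n : ℕ) : ℝ) * ((n : ℝ) ^ 2)⁻¹ :=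
                  mul_le_mul_of_nonneg_left hq (by positivity)
              _ = (k : ℝ) / n := by push_cast; field_simp
  simpa using (hpow.const_mul 2).mul (hpow.sub_const 1)

open Classical in
theorem minDegree_le_card_mem_edge (G : SimpleGraph V) [DecidableRel G.Adj]
    [Fintype G.edgeSet] (v : V) :
    G.minDegree ≤ (Finset.univ.filter fun e : G.edgeSet => v ∈ (e : Sym2 V)).card := by
  refine (G.minDegree_le_degree v).trans (le_of_eq ?_)
  rw [← G.card_incidenceFinset_eq_degree v, ← Finset.card_map (Function.Embedding.subtype _)]
  congr 1
  ext e
  simp [SimpleGraph.incidenceSet, and_comm]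

end RainbowOut

end

/-! ### The main theorem -/

theorem mainTheorem2 (ε : ℝ) (hε : 0 < ε) (k : ℕ) (hk : 2 ≤ k)
    (G : ∀ n : ℕ, SimpleGraph (Fin n)) [∀ n, DecidableRel (G n).Adj]
    (hG : (fun n : ℕ => Real.log n) =o[atTop] fun n => ((G n).minDegree : ℝ))
    (p : ℕ → unitInterval) (hp_pos : ∀ n, 0 < p n)
    (hp : (fun n : ℕ => Real.log n / ((G n).minDegree : ℝ)) =o[atTop] fun n => (p n : ℝ))
    (t : ℕ → ℕ) (ht : ∀ n, t n = ⌈(1 - ε) * ((G n).minDegree * (p n : ℝ) / (2 * k))⌉₊) :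
    ∃ μ : ∀ n : ℕ, PMF (RainbowOut.ColouredGraph (Fin n) (k * n) ×
        (Fin (t n + 1) → SimpleGraph (Fin n))),
      (∀ (n : ℕ) (hn : 0 < n), (μ n).map (fun ω => ω.1) =
        RainbowOut.randomColouredSubgraph (G n) (p n) (k * n)
          (Nat.mul_pos (Nat.lt_of_lt_of_le Nat.two_pos hk) hn)) ∧
      (∀ (n : ℕ) (i : Fin (t n + 1)), i ≠ 0 →
        (μ n).map (fun ω => ω.2 i) = RainbowOut.randomKOutStar (G n) k) ∧
      Tendsto (fun n => (μ n).toOuterMeasure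
        {ω | RainbowOut.IsRainbowSplitting ω.1 ω.2}) atTop (𝓝 1) := by
  open RainbowOut in
  have hk0 : 0 < k := by omega
  have hne : ∀ n, n ≠ 0 → Nonempty (Fin (k * n)) := fun n hn =>
    ⟨⟨0, Nat.mul_pos hk0 (Nat.pos_of_ne_zero hn)⟩⟩
  have hedge : ∀ K : SimpleGraph (Fin 0), IsEmpty K.edgeSet := fun K =>
    ⟨fun e => (Quot.out (e : Sym2 (Fin 0))).1.elim0⟩
  -- For `n = 0` there is no colour to draw from; a point mass suffices, as there is only one graph
  -- on `Fin 0`.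
  refine ⟨fun n => if hn : n = 0 then
      PMF.pure (⟨⊥, fun e => by subst hn; exact ((hedge _).false e).elim⟩, fun _ => ⊥)
    else haveI := hne n hn; coupling (G n) (p n) (k * n) k (t n), ?_, ?_, ?_⟩
  · intro n hn
    beta_reduce
    rw [dif_neg hn.ne']
    have := hne n hn.ne'
    exact coupling_map_fst _ _ _ _ _ _
  · intro n i hi
    by_cases hn : n = 0
    · subst hn
      have hsub : ∀ P Q : PMF (SimpleGraph (Fin 0)), P = Q := by
        intro P Q
        ext K
        have h : ∀ R : PMF (SimpleGraph (Fin 0)), R K = 1 := fun R => by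
          rw [← R.tsum_coe, tsum_eq_single K fun K' h => absurd (Subsingleton.elim K' K) h]
        rw [h, h]
      exact hsub _ _
    · beta_reduce
      rw [dif_neg hn]
      have := hne n hn
      exact coupling_map_snd _ _ _ _ _ _ hi
  · set d : ℕ → ℝ := fun n => (G n).minDegree * (p n : ℝ) / (2 * k) with hd
    have hd0 : ∀ n, 0 ≤ d n := fun n => by
      have := (p n).2.1
      simp only [hd]
      positivity
    have hlog : Tendsto (fun n : ℕ => Real.log n) atTop atTop :=
      Real.tendsto_log_atTop.comp tendsto_natCast_atTop_atTop
    have hdlog : (fun n : ℕ => Real.log n) =o[atTop] d := by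
      have h1 : (fun n : ℕ => Real.log n) =o[atTop] fun n => ((G n).minDegree * (p n : ℝ)) := by
        refine ((isBigO_refl (fun n => ((G n).minDegree : ℝ)) atTop).mul_isLittleO hp).congr' ?_
          EventuallyEq.rfl
        filter_upwards [hG.bound one_pos, hlog.eventually_gt_atTop 0] with n hn hn0
        have : ((G n).minDegree : ℝ) ≠ 0 := by
          intro h
          rw [h, norm_zero, mul_zero, Real.norm_of_nonneg hn0.le] at hn
          linarith
        field_simp
      have h2 := h1.const_mul_right (c := (2 * (k : ℝ))⁻¹) (by positivity)
      refine h2.congr_right fun n => ?_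
      simp only [hd]
      ring
    have hdtop : Tendsto d atTop atTop := by
      have h1 := hdlog.bound one_pos
      refine tendsto_atTop_mono' _ ?_ hlog
      filter_upwards [h1] with n hn
      rw [one_mul, Real.norm_of_nonneg (hd0 n)] at hn
      exact (le_abs_self _).trans hn
    -- Half of the slack absorbs the ceiling: when `(1 - ε)d ≥ 0`, `t ≤ (1 - 2η)d + 1 ≤ (1 - η)d`
    -- once `ηd ≥ 1`. The minimum with 1 keeps `1 - η` nonnegative for large `ε`, where `t = 0`.
    set η : ℝ := min ε 1 / 2 with hη
    have hη0 : 0 < η := by positivity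
    have hη1 : 2 * η ≤ 1 := by
      have := min_le_right ε 1
      linarith
    have hηε : 2 * η ≤ ε := by
      have := min_le_left ε 1
      linarith
    have hbound := tendsto_failure_bound k (a := η ^ 2 / 8) (by positivity) d hdlog hd0
    have hbound' := ENNReal.tendsto_ofReal hbound
    rw [ENNReal.ofReal_zero] at hbound'
    have hone : Tendsto (fun n => (1 : ℝ≥0∞) - ENNReal.ofReal
        (2 * (1 + Real.exp (-(η ^ 2 / 8 * d n))) ^ (k * n) *
          ((1 + Real.exp (-(η ^ 2 / 8 * d n))) ^ (k * n) - 1))) atTop (𝓝 1) := by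
      simpa using ENNReal.Tendsto.sub (tendsto_const_nhds (x := (1 : ℝ≥0∞))) hbound'
        (Or.inl ENNReal.one_ne_top)
    have huniv : ∀ {α : Type} (P : PMF α), P.toOuterMeasure Set.univ = 1 := fun P =>
      (P.toOuterMeasure_apply_eq_one_iff _).2 (Set.subset_univ _)
    refine tendsto_of_tendsto_of_tendsto_of_le_of_le' hone tendsto_const_nhds ?_ ?_
    · filter_upwards [eventually_ne_atTop 0, hdtop.eventually_ge_atTop (1 / η)] with n hn hdn
      rw [dif_neg hn]
      have := hne n hn
      have htn : (t n : ℝ) ≤ (1 - η) * d n := by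
        have h1 : 1 ≤ η * d n := by
          rw [div_le_iff₀ hη0] at hdn
          linarith
        rw [ht]
        rcases le_total 0 ((1 - ε) * d n) with h | h
        · have := Nat.ceil_lt_add_one h
          have h2 := mul_le_mul_of_nonneg_right hηε (hd0 n)
          simp only [hd] at *
          linarith
        · rw [Nat.ceil_eq_zero.2 h, Nat.cast_zero]
          exact mul_nonneg (by linarith) (hd0 n)
      have hf := coupling_failure_le (G := G n) (p n) (c := k * n) hk0 (by simp)
        (fun v => by convert minDegree_le_card_mem_edge (G n) v) hη0 (by linarith) (d := d n) rfl htn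
      rw [show η ^ 2 * d n / 8 = η ^ 2 / 8 * d n by ring] at hf
      rw [tsub_le_iff_right]
      refine le_trans ?_ (add_le_add_right hf _)
      rw [← huniv (coupling (G n) (p n) (k * n) k (t n)), ← Set.union_compl_self
        {ω : ColouredGraph (Fin n) (k * n) × (Fin (t n + 1) → SimpleGraph (Fin n)) |
          IsRainbowSplitting ω.1 ω.2}]
      exact MeasureTheory.measure_union_le _ _
    · refine Eventually.of_forall fun n => ?_
      exact (MeasureTheory.measure_mono (Set.subset_univ _)).trans (huniv _).le
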